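/- **Setting.** Let $\mathfrak n$ be a non-abelian real Lie algebra of dimension $n=m+2d$ with a basis $Z_1,\dots,Z_m,Y_1,\dots,Y_d,X_1,\dots,X_d$ such that $\operatorname{span}\{Z_k\}$ is the centre $\mathfrak z(\mathfrak n)$, $\mathfrak a=\operatorname{span}\{Y_k\}$ and $\mathfrak b=\operatorname{span}\{X_k\}$ are commutative, $[\mathfrak a,\mathfrak b]\subseteq\mathfrak z(\mathfrak n)$, and $\det\big(\lambda([X_i,Y_j])\big)_{i,j}$ is not identically zero in $\lambda\in\mathfrak n^*$. Let $N=\exp\mathfrak n$ be the connected, simply connected Lie group with Lie algebra $\mathfrak n$, with Haar measure $dz\,dy\,dx$ in the coordinates $(z,y,x)\mapsto\exp(\sum z_kZ_k)\exp(\sum y_kY_k)\exp(\sum x_kX_k)$. Let $(L(g)f)(x)=f(g^{-1}x)$ on $L^2(N)$ and $$\Gamma=\exp\Big(\sum_k\mathbb Z Z_k\Big)\exp\Big(\sum_k\mathbb Z Y_k\Big)\exp\Big(\sum_k\mathbb Z X_k\Big)\subset N.$$ Let $U$ be the derivation of $\mathfrak n$ with $U Z_k=\ln(2)Z_k$, $U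 Y_k=\ln(2)Y_k$, $U X_k=0$, let $A=\exp U\in\operatorname{Aut}(N)$ (so that $A$ scales the centre and $\mathfrak a$ by $2$ and fixes $\mathfrak b$), and for $j\in\mathbb Z$ let $$(D_{A^j}f)(x)=\det(\mathrm{Ad}_A)^{-j/2}f(A^{-j}x)=2^{-j(n-d)/2}f(A^{-j}x).$$ Identify the functionals $\lambda\in\mathfrak n^*$ vanishing on $\mathfrak a\oplus\mathfrak b$ with $(\lambda(Z_1),\dots,\lambda(Z_m))\in\mathbb R^m$, put $B(\lambda)=\big(\lambda([X_i,Y_j])\big)_{i,j}$ and $\Sigma=\{\lambda\in\mathbb R^m:\det B(\lambda)\ne0\}$. For $\lambda\in\Sigma$ let $\pi_\lambda$ be the irreducible unitary representation of $N$ on $L^2(\mathbb R^d)$ in which $\exp(\sum z_kZ_k)$, $\exp(\sum y_kY_k)$, $\exp(\sum x_kX_k)$ send $\phi(t)$ to $e^{2\pi i\langle\lambda,z\rangle}\phi(t)$, $e^{-2\pi i\langle t,B(\lambda)y\rangle}\phi(t)$, $\phi(t-x)$ respectively. The Plancherel transform $$\mathcal P:L^2(N)\to\int_\Sigma^\oplus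 L^2(\mathbb R^d)\otimes L^2(\mathbb R^d)\,|\det B(\lambda)|\,d\lambda$$ is the continuous extension of the Fourier transform $\mathcal Ff(\lambda)=\int_N f(x)\pi_\lambda(x)\,dx$ (weakly defined) from $L^1(N)\cap L^2(N)$; here $L^2(\mathbb R^d)\otimes L^2(\mathbb R^d)$ is the space of Hilbert–Schmidt operators, $\phi\otimes v$ being $w\mapsto\langle w,v\rangle\phi$. Let $$E=\big([-\tfrac12,\tfrac12]^m\setminus[-\tfrac14,\tfrac14]^m\big)\cap\Sigma,$$ fix $\mathbf u\in L^2(\mathbb R^d)$ with $\|\mathbf u\|=1$, and for $j\in\mathbb Z$ put $$\mathbf H_E^j=\mathcal P^{-1}\Big(\int_{2^{-j}E}^\oplus\big(L^2(\mathbb R^d)\otimes\mathbf u\big)|\det B(\lambda)|\,d\lambda\Big),\qquad \mathbf H_E=\mathcal P^{-1}\Big(\int_{E}^\oplus\big(L^2(\mathbb R^d)\otimes\mathbf u\big)|\det B(\lambda)|\,d\lambda\Big).$$ A family $(v_i)$ is a Parseval frame for a subspace $K$ if every $v_i\in K$ and $\sum_i|\langle g,v_i\rangle|^2=\|g\|^2$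 for all $g\in K$. A closed left-invariant subspace of $L^2(N)$ is multiplicity-free if it equals $\mathcal P^{-1}\big(\int_\Sigma^\oplus L^2(\mathbb R^d)\otimes P_\lambda(L^2(\mathbb R^d))\,|\det B(\lambda)|\,d\lambda\big)$ for a measurable field of orthogonal projections $P_\lambda$ that have rank one for almost every $\lambda\in\Sigma$. **Theorem.** Let $f\in L^2(N)$ be such that $\{L(\gamma)f:\gamma\in\Gamma\}$ is a Parseval frame for $\mathbf H_E$. Then $\{D_{A^j}L(\gamma)f:\gamma\in\Gamma,\ j\in\mathbb Z\}$ is a Parseval frame for the space $$\bigoplus_{j\in\mathbb Z}\mathbf H_E^j=\mathcal P^{-1}\Big(\int_\Sigma^\oplus\big(L^2(\mathbb R^d)\otimes\mathbf u\big)|\det B(\lambda)|\,d\lambda\Big),$$ which is a multiplicity-free closed left-invariant subspace of $L^2(N)$; here the spaces $\mathbf H_E^j$ are pairwise orthogonal and the equality (of the closed linear span of the $\mathbf H_E^j$ with the space on the right) is part of the assertion. -/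

import Mathlib

open MeasureTheory
open scoped ENNReal InnerProductSpace ComplexConjugate

noncomputable section

/-! ### The class of Lie algebras -/

/-- A basis `Z₁,…,Z_m, Y₁,…,Y_d, X₁,…,X_d` of a real Lie algebra `𝔫` of dimension `n = m + 2d`
such that `𝔫 = 𝔷(𝔫) ⊕ 𝔞 ⊕ 𝔟`, where the `Z`'s span the centre, `𝔞 = span Y` and `𝔟 = span X` are
commutative, `[𝔞, 𝔟] ⊆ 𝔷(𝔫)`, and `det ([X_i, Y_j])` is not the zero polynomial function on the
dual of `𝔫`. -/
structure JHBasis (m d : ℕ) (𝔫 : Type*) [LieRing 𝔫] [LieAlgebra ℝ 𝔫] where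
  basis : Module.Basis (Fin m ⊕ Fin d ⊕ Fin d) ℝ 𝔫
  span_Z : Submodule.span ℝ (Set.range fun k => basis (.inl k)) =
    (LieAlgebra.center ℝ 𝔫).toSubmodule
  lie_Y_Y : ∀ i j, ⁅basis (.inr (.inl i)), basis (.inr (.inl j))⁆ = 0
  lie_X_X : ∀ i j, ⁅basis (.inr (.inr i)), basis (.inr (.inr j))⁆ = 0
  lie_X_Y : ∀ i j, ⁅basis (.inr (.inr i)), basis (.inr (.inl j))⁆ ∈ LieAlgebra.center ℝ 𝔫
  det_ne_zero : ∃ l : Module.Dual ℝ 𝔫,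
    (Matrix.of fun i j => l ⁅basis (.inr (.inr i)), basis (.inr (.inl j))⁆).det ≠ 0

namespace JHBasis

variable {m d : ℕ} {𝔫 : Type*} [LieRing 𝔫] [LieAlgebra ℝ 𝔫] (J : JHBasis m d 𝔫)

def Z (k : Fin m) : 𝔫 := J.basis (.inl k)
def Y (i : Fin d) : 𝔫 := J.basis (.inr (.inl i))
def X (i : Fin d) : 𝔫 := J.basis (.inr (.inr i))

/-- `z ↦ ∑ z_k Z_k`. -/
def linZ : (Fin m → ℝ) →ₗ[ℝ] 𝔫 := Fintype.linearCombination ℝ J.Z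
/-- `y ↦ ∑ y_k Y_k`. -/
def linY : (Fin d → ℝ) →ₗ[ℝ] 𝔫 := Fintype.linearCombination ℝ J.Y
/-- `x ↦ ∑ x_k X_k`. -/
def linX : (Fin d → ℝ) →ₗ[ℝ] 𝔫 := Fintype.linearCombination ℝ J.X

/-- The bracket as a bilinear map. -/
def br (𝔫 : Type*) [LieRing 𝔫] [LieAlgebra ℝ 𝔫] : 𝔫 →ₗ[ℝ] 𝔫 →ₗ[ℝ] 𝔫 :=
  (LieModule.toEnd ℝ 𝔫 𝔫 : 𝔫 →ₗ[ℝ] Module.End ℝ 𝔫)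

@[simp] theorem br_apply (v w : 𝔫) : br 𝔫 v w = ⁅v, w⁆ := rfl

theorem mem_center_iff {v : 𝔫} : v ∈ LieAlgebra.center ℝ 𝔫 ↔ ∀ w : 𝔫, ⁅w, v⁆ = 0 := by
  rw [LieModule.mem_maxTrivSubmodule]

theorem Z_mem_center (k : Fin m) : J.Z k ∈ LieAlgebra.center ℝ 𝔫 := by
  have : J.Z k ∈ (LieAlgebra.center ℝ 𝔫).toSubmodule := by
    rw [← J.span_Z]; exact Submodule.subset_span ⟨k, rfl⟩
  exact this

theorem lie_Z (w : 𝔫) (k : Fin m) : ⁅w, J.Z k⁆ = 0 := mem_center_iff.1 (J.Z_mem_center k) w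

theorem Z_lie (w : 𝔫) (k : Fin m) : ⁅J.Z k, w⁆ = 0 := by rw [← lie_skew, J.lie_Z, neg_zero]

theorem lie_basis_mem_center (i j : Fin m ⊕ Fin d ⊕ Fin d) :
    ⁅J.basis i, J.basis j⁆ ∈ LieAlgebra.center ℝ 𝔫 := by
  rcases i with i | i | i <;> rcases j with j | j | j
  all_goals first
    | (rw [show ⁅J.basis _, J.basis (.inl _)⁆ = 0 from J.lie_Z _ _]; exact zero_mem _)
    | (rw [show ⁅J.basis (.inl _), J.basis _⁆ = 0 from J.Z_lie _ _]; exact zero_mem _)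
    | (rw [J.lie_Y_Y]; exact zero_mem _)
    | (rw [J.lie_X_X]; exact zero_mem _)
    | exact J.lie_X_Y _ _
    | (rw [← lie_skew]; exact neg_mem (J.lie_X_Y _ _))

theorem lie_lie (J : JHBasis m d 𝔫) (u v w : 𝔫) : ⁅u, ⁅v, w⁆⁆ = 0 := by
  have h : (br 𝔫).compr₂ (br 𝔫 u) = 0 :=
    LinearMap.ext_basis J.basis J.basis fun i j => by
      simpa using mem_center_iff.1 (J.lie_basis_mem_center i j) u
  simpa using LinearMap.congr_fun₂ h v w

theorem lie_lie' (J : JHBasis m d 𝔫) (u v w : 𝔫) : ⁅⁅u, v⁆, w⁆ = 0 := by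
  rw [← lie_skew, J.lie_lie, neg_zero]

/-! ### The simply connected Lie group -/

/-- The connected, simply connected Lie group `N` with (two step nilpotent) Lie algebra `𝔫`,
realised on `𝔫` through the exponential map, with the Baker-Campbell-Hausdorff product
`exp v * exp w = exp (v + w + [v, w] / 2)`. -/
@[ext] structure Grp (J : JHBasis m d 𝔫) : Type _ where
  exp ::
  log : 𝔫

namespace Grp
variable {J}

instance : Mul J.Grp := ⟨fun g h => exp (g.log + h.log + (2⁻¹ : ℝ) • ⁅g.log, h.log⁆)⟩
instance : One J.Grp := ⟨exp 0⟩
instance : Inv J.Grp := ⟨fun g => exp (-g.log)⟩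

@[simp] theorem log_mul (g h : J.Grp) :
    (g * h).log = g.log + h.log + (2⁻¹ : ℝ) • ⁅g.log, h.log⁆ := rfl
@[simp] theorem log_one : (1 : J.Grp).log = 0 := rfl
@[simp] theorem log_inv (g : J.Grp) : (g⁻¹).log = -g.log := rfl

instance : Group J.Grp := Group.ofLeftAxioms
  (fun a b c => by
    ext
    simp only [log_mul, lie_add, add_lie, lie_smul, smul_lie, J.lie_lie, J.lie_lie', smul_zero,
      add_zero]
    module)
  (fun a => by ext; simp)
  (fun a => by ext; simp)

end Grp

/-- The point with coordinates `(z, y, x)`, i.e. `exp(∑ z_k Z_k) exp(∑ y_k Y_k) exp(∑ x_k X_k)`. -/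
def ofCoords (p : (Fin m → ℝ) × (Fin d → ℝ) × (Fin d → ℝ)) : J.Grp :=
  Grp.exp (J.linZ p.1) * Grp.exp (J.linY p.2.1) * Grp.exp (J.linX p.2.2)

theorem lie_linZ (w : 𝔫) (z : Fin m → ℝ) : ⁅w, J.linZ z⁆ = 0 := by
  have h : (br 𝔫 w) ∘ₗ J.linZ = 0 := by
    refine (Pi.basisFun ℝ (Fin m)).ext fun k => ?_
    simp [linZ, J.lie_Z]
  simpa using LinearMap.congr_fun h z

theorem linZ_lie (w : 𝔫) (z : Fin m → ℝ) : ⁅J.linZ z, w⁆ = 0 := by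
  rw [← lie_skew, J.lie_linZ, neg_zero]

theorem lie_linY (y y' : Fin d → ℝ) : ⁅J.linY y, J.linY y'⁆ = 0 := by
  have h : (br 𝔫).compl₁₂ J.linY J.linY = 0 :=
    LinearMap.ext_basis (Pi.basisFun ℝ (Fin d)) (Pi.basisFun ℝ (Fin d)) fun i j => by
      simpa [linY, Y] using J.lie_Y_Y i j
  simpa using LinearMap.congr_fun₂ h y y'

theorem lie_linX (x x' : Fin d → ℝ) : ⁅J.linX x, J.linX x'⁆ = 0 := by
  have h : (br 𝔫).compl₁₂ J.linX J.linX = 0 :=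
    LinearMap.ext_basis (Pi.basisFun ℝ (Fin d)) (Pi.basisFun ℝ (Fin d)) fun i j => by
      simpa [linX, X] using J.lie_X_X i j
  simpa using LinearMap.congr_fun₂ h x x'

theorem log_ofCoords (p : (Fin m → ℝ) × (Fin d → ℝ) × (Fin d → ℝ)) :
    (J.ofCoords p).log = J.linZ p.1 + J.linY p.2.1 + J.linX p.2.2
      + (2⁻¹ : ℝ) • ⁅J.linY p.2.1, J.linX p.2.2⁆ := by
  simp [ofCoords, J.linZ_lie]

/-- The `Z`-coordinates with respect to the basis. -/
def projZ : 𝔫 →ₗ[ℝ] (Fin m → ℝ) := LinearMap.pi fun k => J.basis.coord (.inl k)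
def projY : 𝔫 →ₗ[ℝ] (Fin d → ℝ) := LinearMap.pi fun k => J.basis.coord (.inr (.inl k))
def projX : 𝔫 →ₗ[ℝ] (Fin d → ℝ) := LinearMap.pi fun k => J.basis.coord (.inr (.inr k))

theorem proj_sum (v : 𝔫) : J.linZ (J.projZ v) + J.linY (J.projY v) + J.linX (J.projX v) = v := by
  conv_rhs => rw [← J.basis.sum_repr v, Fintype.sum_sum_type, Fintype.sum_sum_type]
  simp [linZ, linY, linX, projZ, projY, projX, Fintype.linearCombination_apply,
    Z, Y, X, add_assoc]

theorem projZ_lin (z : Fin m → ℝ) (y x : Fin d → ℝ) :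
    J.projZ (J.linZ z) = z ∧ J.projZ (J.linY y) = 0 ∧ J.projZ (J.linX x) = 0 := by
  refine ⟨?_, ?_, ?_⟩ <;> ext k <;>
  simp [linZ, linY, linX, projZ, Fintype.linearCombination_apply, Z, Y, X, Finsupp.single_apply]

theorem projY_lin (z : Fin m → ℝ) (y x : Fin d → ℝ) :
    J.projY (J.linZ z) = 0 ∧ J.projY (J.linY y) = y ∧ J.projY (J.linX x) = 0 := by
  refine ⟨?_, ?_, ?_⟩ <;> ext k <;>
  simp [linZ, linY, linX, projY, Fintype.linearCombination_apply, Z, Y, X, Finsupp.single_apply]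

theorem projX_lin (z : Fin m → ℝ) (y x : Fin d → ℝ) :
    J.projX (J.linZ z) = 0 ∧ J.projX (J.linY y) = 0 ∧ J.projX (J.linX x) = x := by
  refine ⟨?_, ?_, ?_⟩ <;> ext k <;>
  simp [linZ, linY, linX, projX, Fintype.linearCombination_apply, Z, Y, X, Finsupp.single_apply]

theorem linZ_projZ_of_mem {v : 𝔫} (hv : v ∈ LieAlgebra.center ℝ 𝔫) : J.linZ (J.projZ v) = v := by
  have h : v ∈ (LieAlgebra.center ℝ 𝔫).toSubmodule := hv
  rw [← J.span_Z] at h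
  have h2 : Submodule.span ℝ (Set.range fun k => J.basis (.inl k)) ≤
      LinearMap.eqLocus (J.linZ ∘ₗ J.projZ) LinearMap.id := by
    rw [Submodule.span_le]
    rintro _ ⟨k, rfl⟩
    have : J.basis (.inl k) = J.linZ (Pi.single k 1) := by simp [linZ, Z]
    simp [this, (J.projZ_lin _ 0 0).1]
  exact h2 h

theorem lie_mem_center (J : JHBasis m d 𝔫) (v w : 𝔫) : ⁅v, w⁆ ∈ LieAlgebra.center ℝ 𝔫 :=
  mem_center_iff.2 fun _ => J.lie_lie _ _ _

theorem projY_lie (v w : 𝔫) : J.projY ⁅v, w⁆ = 0 := by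
  rw [← J.linZ_projZ_of_mem (J.lie_mem_center v w), (J.projY_lin _ 0 0).1]

theorem projX_lie (v w : 𝔫) : J.projX ⁅v, w⁆ = 0 := by
  rw [← J.linZ_projZ_of_mem (J.lie_mem_center v w), (J.projX_lin _ 0 0).1]

/-- The coordinates `(z, y, x)` of a group element `exp(∑ z_k Z_k) exp(∑ y_k Y_k) exp(∑ x_k X_k)`. -/
def coordsEquiv : J.Grp ≃ (Fin m → ℝ) × (Fin d → ℝ) × (Fin d → ℝ) where
  toFun g := (J.projZ g.log
    - (2⁻¹ : ℝ) • J.projZ ⁅J.linY (J.projY g.log), J.linX (J.projX g.log)⁆,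
    J.projY g.log, J.projX g.log)
  invFun := J.ofCoords
  left_inv g := by
    ext
    rw [log_ofCoords]
    simp only [map_sub, map_smul, J.linZ_projZ_of_mem (J.lie_mem_center _ _)]
    conv_rhs => rw [← J.proj_sum g.log]
    module
  right_inv p := by
    obtain ⟨z, y, x⟩ := p
    have hz := J.projZ_lin z y x
    have hy := J.projY_lin z y x
    have hx := J.projX_lin z y x
    simp only [log_ofCoords, map_add, map_smul, hz.1, hz.2.1, hz.2.2, hy.1, hy.2.1, hy.2.2, hx.1,
      hx.2.1, hx.2.2, J.projY_lie, J.projX_lie]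
    simp

instance : MeasurableSpace J.Grp := MeasurableSpace.comap J.coordsEquiv inferInstance

def coords : J.Grp ≃ᵐ (Fin m → ℝ) × (Fin d → ℝ) × (Fin d → ℝ) where
  toEquiv := J.coordsEquiv
  measurable_toFun := comap_measurable _
  measurable_invFun := by
    rintro _ ⟨t, ht, rfl⟩
    have : J.coordsEquiv.symm ⁻¹' (J.coordsEquiv ⁻¹' t) = t := by ext p; simp
    exact (congrArg MeasurableSet this).mpr ht

@[simp] theorem coords_ofCoords (p) : J.coords (J.ofCoords p) = p := J.coordsEquiv.apply_symm_apply p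

@[simp] theorem ofCoords_coords (g) : J.ofCoords (J.coords g) = g := J.coordsEquiv.symm_apply_apply g

theorem coords_symm_apply (p) : J.coords.symm p = J.ofCoords p := rfl

/-- The Haar measure of `N`: Lebesgue measure `dz dy dx` in the coordinates `(z, y, x)`. -/
def haar : Measure J.Grp := Measure.map J.coords.symm volume

theorem measurePreserving_coords_symm : MeasurePreserving J.coords.symm volume J.haar :=
  ⟨J.coords.symm.measurable, rfl⟩

theorem measurePreserving_coords : MeasurePreserving J.coords J.haar volume :=
  J.measurePreserving_coords_symm.symm J.coords.symm

/-- The `Z`-coordinates of `[∑ x_k X_k, ∑ y_k Y_k]`. -/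
def brXY (x : Fin d → ℝ) : (Fin d → ℝ) →ₗ[ℝ] (Fin m → ℝ) :=
  J.projZ ∘ₗ br 𝔫 (J.linX x) ∘ₗ J.linY

theorem ofCoords_mul (z z' : Fin m → ℝ) (y y' x x' : Fin d → ℝ) :
    J.ofCoords (z, y, x) * J.ofCoords (z', y', x')
      = J.ofCoords (z + z' + J.brXY x y', y + y', x + x') := by
  ext
  have h1 : ⁅J.linX x, J.linY y'⁆ = J.linZ (J.brXY x y') :=
    (J.linZ_projZ_of_mem (J.lie_mem_center _ _)).symm
  have h2 : ⁅J.linY y', J.linX x⁆ = -J.linZ (J.brXY x y') := by rw [← lie_skew, h1]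
  simp only [Grp.log_mul, log_ofCoords, map_add, lie_add, add_lie, J.linZ_lie, J.lie_linZ,
    lie_smul, smul_lie, J.lie_lie, J.lie_lie', J.lie_linX, J.lie_linY, h1, h2]
  module

theorem mul_ofCoords (g : J.Grp) (p : (Fin m → ℝ) × (Fin d → ℝ) × (Fin d → ℝ)) :
    g * J.ofCoords p = J.ofCoords ((J.coords g).1 + p.1 + J.brXY (J.coords g).2.2 p.2.1,
      (J.coords g).2.1 + p.2.1, (J.coords g).2.2 + p.2.2) := by
  conv_lhs => rw [← J.ofCoords_coords g]
  exact J.ofCoords_mul _ _ _ _ _ _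

theorem measurePreserving_mul_left (g : J.Grp) :
    MeasurePreserving (fun h => g * h) J.haar J.haar := by
  set a := J.coords g with ha
  have hshear : MeasurePreserving
      (fun q : ((Fin d → ℝ) × (Fin d → ℝ)) × (Fin m → ℝ) =>
        ((a.2.1 + q.1.1, a.2.2 + q.1.2), (a.1 + J.brXY a.2.2 q.1.1) + q.2))
      (volume.prod volume) (volume.prod volume) := by
    refine MeasurePreserving.skew_product
      (f := fun q : (Fin d → ℝ) × (Fin d → ℝ) => (a.2.1 + q.1, a.2.2 + q.2))
      (g := fun q z => (a.1 + J.brXY a.2.2 q.1) + z) ?_ ?_ ?_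
    · exact (measurePreserving_add_left volume a.2.1).prod (measurePreserving_add_left volume a.2.2)
    · have : Continuous fun y => J.brXY a.2.2 y := LinearMap.continuous_of_finiteDimensional _
      have := this.measurable
      fun_prop
    · exact .of_forall fun q => (measurePreserving_add_left volume _).map_eq
  have h1 := (Measure.measurePreserving_swap (μ := (volume : Measure ((Fin d → ℝ) × (Fin d → ℝ))))
    (ν := (volume : Measure (Fin m → ℝ)))).comp
    (hshear.comp (Measure.measurePreserving_swap (μ := (volume : Measure (Fin m → ℝ)))
      (ν := (volume : Measure ((Fin d → ℝ) × (Fin d → ℝ))))))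
  have h2 := J.measurePreserving_coords_symm.comp (h1.comp J.measurePreserving_coords)
  convert h2 using 1
  ext1 h
  conv_lhs => rw [← J.ofCoords_coords h, J.mul_ofCoords, ← ha]
  simp only [Function.comp_apply, Prod.swap, coords_symm_apply]
  congr 2
  abel

/-! ### The dilation `A = exp U` -/

/-- The eigenvalues of `U`. -/
def weight : Fin m ⊕ Fin d ⊕ Fin d → ℝ :=
  Sum.elim (fun _ => Real.log 2) (Sum.elim (fun _ => Real.log 2) fun _ => 0)

/-- The linear map with `U Z = log 2 • Z`, `U Y = log 2 • Y`, `U X = 0`. -/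
def linU : 𝔫 →ₗ[ℝ] 𝔫 := J.basis.constr ℝ fun i => weight i • J.basis i

theorem linU_basis (i) : J.linU (J.basis i) = weight i • J.basis i := by
  simp [linU]

/-- The diagonal linear map acting by `r` on the centre and on `𝔞`, and by `s` on `𝔟`. -/
def diagMap (r s : ℝ) : 𝔫 →ₗ[ℝ] 𝔫 := J.basis.constr ℝ fun i =>
  (Sum.elim (fun _ => r) (Sum.elim (fun _ => r) fun _ => s) i : ℝ) • J.basis i

theorem diagMap_basis (r s : ℝ) (i) : J.diagMap r s (J.basis i) =
    (Sum.elim (fun _ => r) (Sum.elim (fun _ => r) fun _ => s) i : ℝ) • J.basis i := by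
  simp [diagMap]

theorem diagMap_linZ (r s : ℝ) (z) : J.diagMap r s (J.linZ z) = J.linZ (r • z) := by
  simp only [linZ, Fintype.linearCombination_apply, map_sum, map_smul, Z, diagMap_basis]
  simp [smul_smul, mul_comm, Finset.smul_sum]

theorem diagMap_linY (r s : ℝ) (y) : J.diagMap r s (J.linY y) = J.linY (r • y) := by
  simp only [linY, Fintype.linearCombination_apply, map_sum, map_smul, Y, diagMap_basis]
  simp [smul_smul, mul_comm, Finset.smul_sum]

theorem diagMap_linX (r s : ℝ) (x) : J.diagMap r s (J.linX x) = J.linX (s • x) := by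
  simp only [linX, Fintype.linearCombination_apply, map_sum, map_smul, X, diagMap_basis]
  simp [smul_smul, mul_comm, Finset.smul_sum]

theorem lie_eq (v w : 𝔫) : ⁅v, w⁆ = ⁅J.linX (J.projX v), J.linY (J.projY w)⁆
    + ⁅J.linY (J.projY v), J.linX (J.projX w)⁆ := by
  conv_lhs => rw [← J.proj_sum v, ← J.proj_sum w]
  simp only [lie_add, add_lie, J.linZ_lie, J.lie_linZ, J.lie_linX, J.lie_linY]
  abel

theorem diagMap_eq (r s : ℝ) (v : 𝔫) : J.diagMap r s v = J.linZ (r • J.projZ v)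
    + J.linY (r • J.projY v) + J.linX (s • J.projX v) := by
  conv_lhs => rw [← J.proj_sum v]
  simp only [map_add, diagMap_linX, diagMap_linY, diagMap_linZ]

theorem diagMap_lie (r s : ℝ) (v w : 𝔫) : J.diagMap r s ⁅v, w⁆ = r • ⁅v, w⁆ := by
  rw [← J.linZ_projZ_of_mem (J.lie_mem_center v w), diagMap_linZ, map_smul]

theorem projX_diagMap (r s : ℝ) (v : 𝔫) : J.projX (J.diagMap r s v) = s • J.projX v := by
  rw [diagMap_eq, map_add, map_add, (J.projX_lin _ 0 0).1, (J.projX_lin 0 _ 0).2.1,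
    (J.projX_lin 0 0 _).2.2, zero_add, zero_add]

theorem projY_diagMap (r s : ℝ) (v : 𝔫) : J.projY (J.diagMap r s v) = r • J.projY v := by
  rw [diagMap_eq, map_add, map_add, (J.projY_lin _ 0 0).1, (J.projY_lin 0 _ 0).2.1,
    (J.projY_lin 0 0 _).2.2, zero_add, add_zero]

theorem linU_eq : J.linU = J.diagMap (Real.log 2) 0 :=
  J.basis.ext fun i => by rw [linU_basis, diagMap_basis]; rfl

/-- `U` is a derivation of `𝔫`. -/
def U : LieDerivation ℝ 𝔫 𝔫 where
  toLinearMap := J.linU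
  leibniz' v w := by
    rw [linU_eq, diagMap_lie, J.lie_eq v w, J.lie_eq v, J.lie_eq w]
    simp only [projX_diagMap, projY_diagMap, zero_smul, map_zero, map_smul, lie_smul,
      lie_zero]
    rw [← lie_skew (J.linY (J.projY v)) (J.linX (J.projX w))]
    module

/-- `Ad_A = exp (t • ad_U)` at time `t`, through the matrix exponential. -/
def expU (t : ℝ) : 𝔫 →ₗ[ℝ] 𝔫 :=
  Matrix.toLin J.basis J.basis
    (NormedSpace.exp (t • LinearMap.toMatrix J.basis J.basis (J.U : 𝔫 →ₗ[ℝ] 𝔫)))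

theorem expU_eq (t : ℝ) : J.expU t = J.diagMap (Real.exp (t * Real.log 2)) 1 := by
  have h : t • LinearMap.toMatrix J.basis J.basis (J.U : 𝔫 →ₗ[ℝ] 𝔫)
      = Matrix.diagonal fun i => t * weight i := by
    ext i j
    have : (J.U : 𝔫 →ₗ[ℝ] 𝔫) (J.basis j) = weight j • J.basis j := J.linU_basis j
    rw [Matrix.smul_apply, LinearMap.toMatrix_apply, this]
    by_cases hij : i = j
    · subst hij; simp
    · simp [Matrix.diagonal_apply_ne _ hij, Ne.symm hij]
  refine J.basis.ext fun i => ?_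
  rw [expU, h, Matrix.exp_diagonal, Matrix.toLin_self, diagMap_basis]
  simp only [Matrix.diagonal_apply, ite_smul, zero_smul, Finset.sum_ite_eq', Finset.mem_univ,
    if_true, Pi.coe_exp, ← Real.exp_eq_exp_ℝ]
  rcases i with i | i | i <;> simp [weight]

theorem expU_one : J.expU 1 = J.diagMap 2 1 := by
  rw [expU_eq, one_mul, Real.exp_log (by norm_num)]

theorem expU_neg_one : J.expU (-1) = J.diagMap 2⁻¹ 1 := by
  rw [expU_eq, neg_one_mul, Real.exp_neg, Real.exp_log (by norm_num)]

theorem diagMap_diagMap (r s : ℝ) (h : r * s = 1) (v : 𝔫) :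
    J.diagMap r 1 (J.diagMap s 1 v) = v := by
  rw [J.diagMap_eq s, map_add, map_add, diagMap_linZ, diagMap_linY, diagMap_linX, smul_smul,
    smul_smul, h]
  simpa using J.proj_sum v

/-- The automorphism `A = exp U` of `N`; its differential is `Ad_A = exp ad_U`. -/
def A : MulAut J.Grp where
  toFun g := Grp.exp (J.expU 1 g.log)
  invFun g := Grp.exp (J.expU (-1) g.log)
  left_inv g := by
    ext
    simp only [expU_one, expU_neg_one]
    exact J.diagMap_diagMap _ _ (by norm_num) _
  right_inv g := by
    ext
    simp only [expU_one, expU_neg_one]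
    exact J.diagMap_diagMap _ _ (by norm_num) _
  map_mul' g h := by
    ext
    simp only [Grp.log_mul, map_add, map_smul, expU_one, diagMap_lie]
    congr 2
    rw [J.lie_eq g.log h.log, J.lie_eq (J.diagMap 2 1 g.log)]
    simp only [projX_diagMap, projY_diagMap, map_smul, lie_smul, smul_lie, one_smul, smul_add]

theorem A_ofCoords (z : Fin m → ℝ) (y x : Fin d → ℝ) :
    J.A (J.ofCoords (z, y, x)) = J.ofCoords ((2 : ℝ) • z, (2 : ℝ) • y, x) := by
  have h (v : 𝔫) : J.A (Grp.exp v) = Grp.exp (J.diagMap 2 1 v) := by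
    rw [← expU_one]; rfl
  rw [ofCoords, map_mul, map_mul, h, h, h, diagMap_linZ, diagMap_linY, diagMap_linX, one_smul]
  rfl

theorem A_zpow_ofCoords (j : ℤ) (z : Fin m → ℝ) (y x : Fin d → ℝ) :
    (J.A ^ j) (J.ofCoords (z, y, x)) = J.ofCoords ((2 : ℝ) ^ j • z, (2 : ℝ) ^ j • y, x) := by
  induction j generalizing z y x with
  | zero => simp
  | succ k ih =>
    rw [zpow_add_one, MulAut.mul_apply, A_ofCoords, ih, smul_smul, smul_smul,
      zpow_add_one₀ (by norm_num)]
  | pred k ih =>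
    have h : J.A⁻¹ (J.ofCoords (z, y, x)) = J.ofCoords ((2 : ℝ)⁻¹ • z, (2 : ℝ)⁻¹ • y, x) := by
      rw [MulAut.inv_apply, MulEquiv.symm_apply_eq, A_ofCoords]
      simp [smul_smul]
    rw [zpow_sub_one, MulAut.mul_apply, h, ih, smul_smul, smul_smul, zpow_sub_one₀ (by norm_num)]

theorem exists_map_A_zpow (j : ℤ) : Measurable ⇑(J.A ^ j) ∧ ∃ c : ℝ≥0∞, c ≠ ∞ ∧
    Measure.map ⇑(J.A ^ j) J.haar = c • J.haar := by
  set r : ℝ := (2 : ℝ) ^ j with hr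
  have hr0 : r ≠ 0 := by positivity
  let T : (Fin m → ℝ) × (Fin d → ℝ) × (Fin d → ℝ) → (Fin m → ℝ) × (Fin d → ℝ) × (Fin d → ℝ) :=
    Prod.map (r • ·) (Prod.map (r • ·) id)
  have hT : Measurable T :=
    (measurable_const_smul r).prodMap ((measurable_const_smul r).prodMap measurable_id)
  have hA : ⇑(J.A ^ j) = J.coords.symm ∘ T ∘ J.coords := by
    ext1 g
    conv_lhs => rw [← J.ofCoords_coords g]
    exact J.A_zpow_ofCoords j _ _ _
  refine ⟨by rw [hA]; fun_prop, ?_⟩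
  have hTv : ∃ c : ℝ≥0∞, c ≠ ∞ ∧ Measure.map T volume = c • volume := by
    refine ⟨ENNReal.ofReal |(r ^ m)⁻¹| * ENNReal.ofReal |(r ^ d)⁻¹|,
      ENNReal.mul_ne_top ENNReal.ofReal_ne_top ENNReal.ofReal_ne_top, ?_⟩
    have e1 := Measure.map_addHaar_smul (volume : Measure (Fin m → ℝ)) hr0
    have e2 := Measure.map_addHaar_smul (volume : Measure (Fin d → ℝ)) hr0
    rw [Module.finrank_fin_fun] at e1 e2
    rw [Measure.volume_eq_prod, Measure.volume_eq_prod,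
      ← Measure.map_prod_map _ _ (measurable_const_smul r)
        ((measurable_const_smul r).prodMap measurable_id),
      ← Measure.map_prod_map _ _ (measurable_const_smul r) measurable_id, e1, e2, Measure.map_id,
      Measure.prod_smul_left, Measure.prod_smul_left, Measure.prod_smul_right, smul_smul]
  obtain ⟨c, hc, h⟩ := hTv
  refine ⟨c, hc, ?_⟩
  rw [hA, ← Measure.map_map J.coords.symm.measurable (hT.comp J.coords.measurable),
    ← Measure.map_map hT J.coords.measurable, J.measurePreserving_coords.map_eq, h,
    Measure.map_smul]
  rfl

/-! ### `L²(N)`, translations and dilations -/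

/-- `L²(N)`. -/
abbrev L2N : Type _ := Lp ℂ 2 J.haar

/-- The left regular representation, `(L(g) f)(x) = f(g⁻¹ x)`. -/
def L (g : J.Grp) : J.L2N →ₗᵢ[ℂ] J.L2N :=
  Lp.compMeasurePreservingₗᵢ ℂ (fun x => g⁻¹ * x) (J.measurePreserving_mul_left g⁻¹)

theorem memLp_dilation (j : ℤ) (f : J.L2N) : MemLp (fun x =>
    (((2 : ℝ) ^ (-(j : ℝ) * ((m + d : ℕ) : ℝ) / 2) : ℝ) : ℂ) * f ((J.A ^ (-j)) x)) 2 J.haar := by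
  obtain ⟨h1, c, hc, h2⟩ := J.exists_map_A_zpow (-j)
  have h : MemLp f 2 (Measure.map ⇑(J.A ^ (-j)) J.haar) := by
    rw [h2]; exact (Lp.memLp f).smul_measure hc
  exact (h.comp_of_map h1.aemeasurable).const_mul _

/-- The dilation `(D_{A^j} f)(x) = det(Ad_A)^{-j/2} f(A^{-j} x)`, where
`det(Ad_A) = 2 ^ (n - d)` and `n = m + 2d`. -/
def D (j : ℤ) (f : J.L2N) : J.L2N := (J.memLp_dilation j f).toLp _

/-- `Γ = exp(∑ ℤ Z_k) exp(∑ ℤ Y_k) exp(∑ ℤ X_k)`. -/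
def Γ : Set J.Grp :=
  {g | ∃ (k : Fin m → ℤ) (l q : Fin d → ℤ), g = Grp.exp (∑ i, (k i : ℝ) • J.Z i) *
    Grp.exp (∑ i, (l i : ℝ) • J.Y i) * Grp.exp (∑ i, (q i : ℝ) • J.X i)}

/-! ### The representations `π_λ` and the Plancherel measure

A functional `λ` on `𝔫` vanishing on `𝔞 ⊕ 𝔟` is identified with `(λ(Z_1), …, λ(Z_m)) ∈ ℝ^m`. -/

/-- The functional on `𝔫` that vanishes on `X`, `Y` and has the given values on the `Z`'s. -/
def dualZ (l : Fin m → ℝ) : Module.Dual ℝ 𝔫 := J.basis.constr ℝ (Sum.elim l fun _ => 0)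

/-- `B(λ) = (λ([X_i, Y_j]))`. -/
def B (l : Fin m → ℝ) : Matrix (Fin d) (Fin d) ℝ := Matrix.of fun i j => J.dualZ l ⁅J.X i, J.Y j⁆

/-- The parameter set `Σ` of the (generic part of the) unitary dual. -/
def sig : Set (Fin m → ℝ) := {l | (J.B l).det ≠ 0}

/-- The Plancherel measure `|det B(λ)| dλ` on `Σ`. -/
def planch : Measure (Fin m → ℝ) :=
  (volume.restrict J.sig).withDensity fun l => ENNReal.ofReal |(J.B l).det|

/-- `L²(ℝ^d)`. -/
abbrev L2R (d : ℕ) : Type := Lp ℂ 2 (volume : Measure (Fin d → ℝ))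

/-- The unimodular factor of `π_λ(exp(∑ z_k Z_k) exp(∑ y_k Y_k) exp(∑ x_k X_k))` at `t`. -/
def phase (l : Fin m → ℝ) (g : J.Grp) (t : Fin d → ℝ) : ℂ :=
  Complex.exp (2 * Real.pi * Complex.I *
    ((l ⬝ᵥ (J.coords g).1 - t ⬝ᵥ (J.B l).mulVec (J.coords g).2.1 : ℝ) : ℂ))

theorem memLp_rep (l : Fin m → ℝ) (g : J.Grp) (φ : L2R d) :
    MemLp (fun t => J.phase l g t * φ (t - (J.coords g).2.2)) 2 volume := by
  have h : MemLp (fun t => φ (t - (J.coords g).2.2)) 2 volume :=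
    (Lp.memLp φ).comp_measurePreserving (measurePreserving_sub_right volume (J.coords g).2.2)
  refine (memLp_congr_norm (Continuous.aestronglyMeasurable ?_ |>.mul h.1) h.1 ?_).2 h
  · unfold phase dotProduct
    fun_prop
  · refine .of_forall fun t => ?_
    have : ‖J.phase l g t‖ = 1 := by
      rw [phase, mul_right_comm, ← Complex.norm_exp_ofReal_mul_I (2 * Real.pi *
        (l ⬝ᵥ (J.coords g).1 - t ⬝ᵥ (J.B l).mulVec (J.coords g).2.1))]
      push_cast
      rfl
    rw [Pi.mul_apply, norm_mul, this, one_mul]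

/-- The irreducible unitary representation `π_λ` of `N` on `L²(ℝ^d)`, where
`π_λ(exp(∑ z_k Z_k)) φ(t) = exp(2πi⟨λ, z⟩) φ(t)`,
`π_λ(exp(∑ y_k Y_k)) φ(t) = exp(-2πi⟨t, B(λ)y⟩) φ(t)`,
`π_λ(exp(∑ x_k X_k)) φ(t) = φ(t - x)`. -/
def rep (l : Fin m → ℝ) (g : J.Grp) (φ : L2R d) : L2R d := (J.memLp_rep l g φ).toLp _

/-! ### The Plancherel transform -/

/-- The Hilbert-Schmidt operators `L²(ℝ^d) ⊗ L²(ℝ^d)` on `L²(ℝ^d)`: the kernel `K` stands for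
the operator `φ ↦ ∫ K(·, s) φ(s) ds`. -/
abbrev HS (d : ℕ) : Type := Lp ℂ 2 (volume : Measure ((Fin d → ℝ) × (Fin d → ℝ)))

theorem memLp_tensor (φ v : L2R d) :
    MemLp (fun p : (Fin d → ℝ) × (Fin d → ℝ) => φ p.1 * conj (v p.2)) 2 volume := by
  have h1 := (Lp.memLp φ).integrable_norm_pow (p := 2) (by norm_num)
  have h2 := (Lp.memLp v).integrable_norm_pow (p := 2) (by norm_num)
  have hm : AEStronglyMeasurable
      (fun p : (Fin d → ℝ) × (Fin d → ℝ) => φ p.1 * conj (v p.2)) (volume.prod volume) :=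
    (Lp.memLp φ).1.comp_fst.mul
      (Complex.continuous_conj.comp_aestronglyMeasurable (Lp.memLp v).1.comp_snd)
  refine (memLp_two_iff_integrable_sq_norm hm).2 ?_
  simpa [mul_pow] using h1.mul_prod h2

/-- The elementary tensor `φ ⊗ v`, i.e. the operator `w ↦ ⟨w, v⟩ φ`. -/
def tensor (φ v : L2R d) : HS d := (memLp_tensor φ v).toLp _

/-- The matrix coefficient `⟨T φ, ψ⟩ = ∬ K(t, s) φ(s) conj(ψ(t)) ds dt` of the operator `T` with
kernel `K`. -/
def coef (T : HS d) (φ ψ : L2R d) : ℂ := ∫ p, T p * φ p.2 * conj (ψ p.1)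

/-- The subspace `L²(ℝ^d) ⊗ V` of `L²(ℝ^d) ⊗ L²(ℝ^d)`. -/
def tensorSub (V : Submodule ℂ (L2R d)) : Submodule ℂ (HS d) :=
  (Submodule.span ℂ {T | ∃ φ : L2R d, ∃ v ∈ V, T = tensor φ v}).topologicalClosure

/-- The direct integral over `Σ` of `L²(ℝ^d) ⊗ L²(ℝ^d)` against the Plancherel measure. -/
abbrev DirInt : Type := Lp (HS d) 2 J.planch

/-- `T` is the Fourier transform of the integrable function `f`:
`⟨T(λ) φ, ψ⟩ = ∫ f(x) ⟨π_λ(x) φ, ψ⟩ dx` for almost every `λ` and all `φ`, `ψ`. -/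
def IsFourier (f : J.L2N) (T : J.DirInt) : Prop :=
  Integrable f J.haar ∧ ∀ᵐ l ∂J.planch, ∀ φ ψ : L2R d,
    coef (T l) φ ψ = ∫ x, f x * ⟪ψ, J.rep l x φ⟫_ℂ ∂J.haar

/-- The graph of the Plancherel transform `𝒫`, the continuous extension of the Fourier transform
from `L¹(N) ∩ L²(N)` to `L²(N)`: the closure of the graph of the latter. -/
def plancherelGraph : Submodule ℂ (J.L2N × J.DirInt) :=
  (Submodule.span ℂ {p | J.IsFourier p.1 p.2}).topologicalClosure

/-- `∫^⊕ L²(ℝ^d) ⊗ V(λ) |det B(λ)| dλ` for a field `V` of subspaces. -/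
def fieldSub (V : (Fin m → ℝ) → Submodule ℂ (L2R d)) : Submodule ℂ J.DirInt where
  carrier := {T | ∀ᵐ l ∂J.planch, T l ∈ tensorSub (V l)}
  zero_mem' := by
    filter_upwards [Lp.coeFn_zero (HS d) 2 J.planch] with l hl
    rw [hl]; exact zero_mem _
  add_mem' {S T} hS hT := by
    change ∀ᵐ l ∂J.planch, (S + T : J.DirInt) l ∈ tensorSub (V l)
    filter_upwards [Lp.coeFn_add S T, hS, hT] with l hl h1 h2
    rw [hl]; exact add_mem h1 h2
  smul_mem' c T hT := by
    change ∀ᵐ l ∂J.planch, (c • T : J.DirInt) l ∈ tensorSub (V l)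
    filter_upwards [Lp.coeFn_smul c T, hT] with l hl h
    rw [hl]; exact Submodule.smul_mem _ c h

/-- `𝒫⁻¹(∫^⊕ L²(ℝ^d) ⊗ V(λ) |det B(λ)| dλ)`. -/
def pullback (V : (Fin m → ℝ) → Submodule ℂ (L2R d)) : Submodule ℂ J.L2N :=
  (J.plancherelGraph ⊓ (J.fieldSub V).comap (LinearMap.snd ℂ J.L2N J.DirInt)).map
    (LinearMap.fst ℂ J.L2N J.DirInt)

open Classical in
/-- `𝒫⁻¹(∫_S^⊕ L²(ℝ^d) ⊗ u |det B(λ)| dλ)`, for `S ⊆ Σ`. -/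
def H (u : L2R d) (S : Set (Fin m → ℝ)) : Submodule ℂ J.L2N :=
  J.pullback fun l => if l ∈ S then Submodule.span ℂ {u} else ⊥

/-- `E = ([-1/2, 1/2]^m ∖ [-1/4, 1/4]^m) ∩ Σ`. -/
def E : Set (Fin m → ℝ) :=
  (Set.Icc (fun _ => -1 / 2) (fun _ => 1 / 2) \ Set.Icc (fun _ => -1 / 4) (fun _ => 1 / 4)) ∩ J.sig

/-- The space `H_E`. -/
def HE (u : L2R d) : Submodule ℂ J.L2N := J.H u J.E

/-- The space `H_E^j`, the analogue of `H_E` for `2^{-j} E`. -/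
def HEj (u : L2R d) (j : ℤ) : Submodule ℂ J.L2N := J.H u ((fun l => (2 : ℝ) ^ (-j) • l) '' J.E)

/-- A multiplicity-free subspace of `L²(N)`: closed, left-invariant, and equal to
`𝒫⁻¹(∫^⊕ L²(ℝ^d) ⊗ P_λ(L²(ℝ^d)) |det B(λ)| dλ)` for a measurable field of orthogonal projections
`P_λ`, almost all of rank one. -/
def IsMultiplicityFree (K : Submodule ℂ J.L2N) : Prop :=
  IsClosed (K : Set J.L2N) ∧ (∀ g : J.Grp, ∀ f ∈ K, J.L g f ∈ K) ∧
    ∃ P : (Fin m → ℝ) → (L2R d →L[ℂ] L2R d), (∀ l, IsStarProjection (P l)) ∧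
      (∀ φ ψ, Measurable fun l => ⟪ψ, P l φ⟫_ℂ) ∧
      (∀ᵐ l ∂J.planch, Module.finrank ℂ (P l : L2R d →ₗ[ℂ] L2R d).range = 1) ∧
      K = J.pullback fun l => (P l : L2R d →ₗ[ℂ] L2R d).range

end JHBasis

/-- The family `v` is a Parseval frame for the subspace `K` of an inner product space. -/
def IsParsevalFrame {F ι : Type*} [NormedAddCommGroup F] [InnerProductSpace ℂ F]
    (K : Submodule ℂ F) (v : ι → F) : Prop :=
  (∀ i, v i ∈ K) ∧ ∀ g ∈ K, HasSum (fun i => ‖⟪v i, g⟫_ℂ‖ ^ 2) (‖g‖ ^ 2)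

end

/-!
The Plancherel transform is made explicit: the operator at `λ` has the kernel
`(t, s) ↦ (ℱf)(t - s, (-λ, B(λ)ᵀ t))`, where `ℱ` is the ordinary Fourier transform in the variables
`(z, y)`. Hence it is the composite of a partial Fourier transform, which is unitary, and a change
of variables that is measure preserving exactly because the Plancherel measure has the density
`|det B(λ)|` (`measurePreserving_kernelMap`); the complement of `Σ` is a null set (`ae_mem_sig`), so
the resulting map `plancherel` is unitary from `L²(N)` onto the direct integral. On `L¹ ∩ L²` it
agrees with the operator valued Fourier transform (`isFourier_plancherel`), so its graph is the
closure of the graph of the latter (`mem_plancherelGraph`), and `f ∈ 𝒫⁻¹(…)` becomes a pointwise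
condition on `plancherel f` (`mem_pullback`, `mem_H`).

Since `π_λ(A^j x) = π_{2^j λ}(x)`, the unitary operator `D_{A^j}` becomes, up to a scalar, the
dilation `λ ↦ 2^j λ` (`plancherel_D`), so it carries `H_E` onto the space `H_E^j` of the tile
`2^{-j} E`. As `𝔫` is not abelian, `0 ∉ Σ`, and the tiles are pairwise disjoint with union `Σ`. So
`g ∈ H_Σ` splits orthogonally into pieces `g_j ∈ H_E^j` with `‖g‖² = ∑ ‖g_j‖²`
(`hasSum_norm_cut_tile`), and
`∑_γ |⟨D_{A^j} L(γ) f, g⟩|² = ∑_γ |⟨L(γ) f, D_{A^{-j}} g_j⟩|² = ‖g_j‖²` by the frame property in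
`H_E`; summing over `j` gives the frame property in `H_Σ` (`isParsevalFrame_D`).

Left translations act on the transform by `π_λ(g) ⊗ 1` (`coef_plancherel_L`), and
`L²(ℝ^d) ⊗ V` is the space of operators killing the orthogonal complement of `V`
(`mem_tensorSub_iff`), which makes `H_Σ` left-invariant; the constant field of projections onto the
line of `u` shows that it is multiplicity-free.
-/

noncomputable section

/-! ### Isometries between `L²` spaces -/

section General

variable {α β : Type*} [MeasurableSpace α] [MeasurableSpace β] {μ : Measure α} {ν : Measure β}

/-- Composition with a measure preserving map that has a measurable left inverse almost everywhere,
as a unitary map of `L²` spaces. -/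
def l2Congr (f : α → β) (g : β → α) (hf : MeasurePreserving f μ ν) (hg : Measurable g)
    (h : ∀ᵐ a ∂μ, g (f a) = a) : Lp ℂ 2 ν ≃ₗᵢ[ℂ] Lp ℂ 2 μ :=
  LinearIsometryEquiv.ofSurjective (Lp.compMeasurePreservingₗᵢ ℂ f hf) fun F => by
    have hgm : MeasurePreserving g ν μ := ⟨hg, by
      rw [← hf.map_eq, Measure.map_map hg hf.measurable,
        Measure.map_congr (f := g ∘ f) (g := id) h, Measure.map_id]⟩
    refine ⟨Lp.compMeasurePreservingₗᵢ ℂ g hgm F, Lp.ext ?_⟩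
    have h1 := Lp.coeFn_compMeasurePreserving (Lp.compMeasurePreservingₗᵢ ℂ g hgm F) hf
    have h2 := hf.quasiMeasurePreserving.ae (Lp.coeFn_compMeasurePreserving F hgm)
    filter_upwards [h1, h2, h] with a h1 h2 h
    refine h1.trans (h2.trans ?_)
    simp [h]

theorem coeFn_l2Congr (f : α → β) (g : β → α) (hf : MeasurePreserving f μ ν) (hg : Measurable g)
    (h : ∀ᵐ a ∂μ, g (f a) = a) (F : Lp ℂ 2 ν) :
    l2Congr f g hf hg h F =ᵐ[μ] fun a => F (f a) :=
  Lp.coeFn_compMeasurePreserving F hf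

theorem eLpNorm_two_sq {E : Type*} [NormedAddCommGroup E] (f : α → E) :
    eLpNorm f 2 μ ^ 2 = ∫⁻ a, ‖f a‖ₑ ^ 2 ∂μ := by
  have := eLpNorm_nnreal_pow_eq_lintegral (f := f) (μ := μ) (p := 2) (by norm_num)
  simpa using this

theorem enorm_sq_eq_lintegral {E : Type*} [NormedAddCommGroup E] (F : Lp E 2 μ) :
    ‖F‖ₑ ^ 2 = ∫⁻ a, ‖F a‖ₑ ^ 2 ∂μ := by
  rw [Lp.enorm_def, eLpNorm_two_sq]

theorem memLp_two_iff_lintegral {E : Type*} [NormedAddCommGroup E] {f : α → E}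
    (hf : AEStronglyMeasurable f μ) : MemLp f 2 μ ↔ ∫⁻ a, ‖f a‖ₑ ^ 2 ∂μ < ∞ := by
  rw [← eLpNorm_two_sq, MemLp]
  simp [hf, ENNReal.pow_lt_top_iff]

/-- A map into a separable metric space is measurable as soon as its distances to all points are. -/
theorem measurable_of_edist {E : Type*} [PseudoEMetricSpace E] [SecondCountableTopology E]
    [MeasurableSpace E] [BorelSpace E] {f : α → E} (h : ∀ e, Measurable fun a => edist (f a) e) :
    Measurable f := by
  refine measurable_of_isOpen fun s hs => ?_
  obtain ⟨t, -, htc, hts⟩ := TopologicalSpace.isOpen_biUnion_countable s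
    (fun x => Metric.eball x (Metric.infEDist x sᶜ)) fun x _ => Metric.isOpen_eball
  -- By separability, countably many of these balls already cover `s`.
  have : s = ⋃ x ∈ s, Metric.eball x (Metric.infEDist x sᶜ) := by
    apply subset_antisymm
    · intro x hx
      refine Set.mem_biUnion hx (Metric.mem_eball_self ?_)
      rw [pos_iff_ne_zero, Ne, ← Metric.mem_iff_infEDist_zero_of_closed hs.isClosed_compl]
      simpa using hx
    · refine Set.iUnion₂_subset fun x _ y hy => ?_
      by_contra hys
      have := Metric.infEDist_le_edist_of_mem (x := x) (Set.mem_compl hys)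
      rw [Metric.mem_eball, edist_comm] at hy
      exact absurd hy (not_lt.2 this)
  rw [this, ← hts, Set.preimage_iUnion₂]
  refine MeasurableSet.biUnion htc fun x _ => ?_
  exact measurableSet_lt (h x) measurable_const

theorem memLp_mul_prod [SFinite μ] {f : α → ℂ} {g : β → ℂ} (hf : MemLp f 2 μ) (hg : MemLp g 2 ν) :
    MemLp (fun p : α × β => f p.1 * g p.2) 2 (μ.prod ν) := by
  have h1 := hf.integrable_norm_pow (p := 2) (by norm_num)
  have h2 := hg.integrable_norm_pow (p := 2) (by norm_num)
  refine (memLp_two_iff_integrable_sq_norm (hf.1.comp_fst.mul hg.1.comp_snd)).2 ?_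
  simpa [mul_pow] using h1.mul_prod h2

variable [SFinite ν]

theorem memLp_section (F : Lp ℂ 2 (μ.prod ν)) : ∀ᵐ a ∂μ, MemLp (fun s => F (a, s)) 2 ν := by
  have hm := Lp.stronglyMeasurable F
  have h := (memLp_two_iff_lintegral (Lp.memLp F).1).1 (Lp.memLp F)
  rw [lintegral_prod _ (by fun_prop)] at h
  filter_upwards [ae_lt_top (by fun_prop) h.ne] with a ha
  exact (memLp_two_iff_lintegral
    (hm.comp_measurable measurable_prodMk_left).aestronglyMeasurable).2 ha

open Classical in
/-- The section `F(a, ·)` of `F ∈ L²(μ × ν)`, and `0` where that section is not in `L²(ν)`. -/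
def l2Section (F : Lp ℂ 2 (μ.prod ν)) (a : α) : Lp ℂ 2 ν :=
  if h : MemLp (fun s => F (a, s)) 2 ν then h.toLp else 0

theorem coeFn_l2Section (F : Lp ℂ 2 (μ.prod ν)) :
    ∀ᵐ a ∂μ, l2Section F a =ᵐ[ν] fun s => F (a, s) := by
  filter_upwards [memLp_section F] with a ha
  rw [l2Section, dif_pos ha]
  exact ha.coeFn_toLp

/-- Measurability of the sections: `L²(ν)` is separable, and the distances of `F(a, ·)` to fixed
elements of `L²(ν)` are integrals depending on the parameter `a`. -/
theorem aestronglyMeasurable_l2Section [IsSeparable ν] (F : Lp ℂ 2 (μ.prod ν)) :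
    AEStronglyMeasurable (l2Section F) μ := by
  let _ : MeasurableSpace (Lp ℂ 2 ν) := borel _
  have : BorelSpace (Lp ℂ 2 ν) := ⟨rfl⟩
  have : Fact ((2 : ℝ≥0∞) ≠ ∞) := ⟨by norm_num⟩
  have hF : Measurable F := (Lp.stronglyMeasurable F).measurable
  refine Measurable.aestronglyMeasurable (measurable_of_edist fun e => ?_)
  have he : Measurable e := (Lp.stronglyMeasurable e).measurable
  have hS : MeasurableSet {a | MemLp (fun s => F (a, s)) 2 ν} := by
    have : {a | MemLp (fun s => F (a, s)) 2 ν} = {a | ∫⁻ s, ‖F (a, s)‖ₑ ^ 2 ∂ν < ∞} := by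
      ext a
      exact memLp_two_iff_lintegral
        (hF.comp measurable_prodMk_left).aestronglyMeasurable
    rw [this]
    exact measurableSet_lt (Measurable.lintegral_prod_right (by fun_prop)) measurable_const
  have hd (G G' : Lp ℂ 2 ν) : edist G G' = (∫⁻ s, ‖G s - G' s‖ₑ ^ 2 ∂ν) ^ (2⁻¹ : ℝ) := by
    rw [Lp.edist_def, ← eLpNorm_two_sq (f := fun s => G s - G' s), ← ENNReal.rpow_natCast_mul]
    norm_num
    rfl
  simp_rw [hd]
  refine Measurable.pow_const ?_ _
  classical
  have : (fun a => ∫⁻ s, ‖l2Section F a s - e s‖ₑ ^ 2 ∂ν) = fun a =>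
      if a ∈ {a | MemLp (fun s => F (a, s)) 2 ν} then ∫⁻ s, ‖F (a, s) - e s‖ₑ ^ 2 ∂ν
      else ∫⁻ s, ‖e s‖ₑ ^ 2 ∂ν := by
    ext a
    by_cases ha : MemLp (fun s => F (a, s)) 2 ν
    · simp only [Set.mem_ofPred_eq, ha, if_true]
      refine lintegral_congr_ae ?_
      rw [l2Section, dif_pos ha]
      filter_upwards [ha.coeFn_toLp] with s hs
      rw [hs]
    · simp only [Set.mem_ofPred_eq, ha, if_false]
      refine lintegral_congr_ae ?_
      rw [l2Section, dif_neg ha]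
      filter_upwards [Lp.coeFn_zero ℂ 2 ν] with s hs
      rw [hs, Pi.zero_apply, zero_sub, enorm_neg]
  rw [this]
  exact Measurable.ite hS (Measurable.lintegral_prod_right (by fun_prop)) measurable_const

theorem lintegral_l2Section (F : Lp ℂ 2 (μ.prod ν)) :
    ∫⁻ a, ‖l2Section F a‖ₑ ^ 2 ∂μ = ‖F‖ₑ ^ 2 := by
  have hF : Measurable F := (Lp.stronglyMeasurable F).measurable
  rw [enorm_sq_eq_lintegral, lintegral_prod _ (by fun_prop)]
  refine lintegral_congr_ae ?_
  filter_upwards [coeFn_l2Section F] with a ha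
  rw [enorm_sq_eq_lintegral]
  refine lintegral_congr_ae ?_
  filter_upwards [ha] with s hs
  rw [hs]

theorem memLp_l2Section [IsSeparable ν] (F : Lp ℂ 2 (μ.prod ν)) :
    MemLp (l2Section F) 2 μ := by
  rw [memLp_two_iff_lintegral (aestronglyMeasurable_l2Section F), lintegral_l2Section]
  exact ENNReal.pow_lt_top enorm_lt_top

/-- The map `F ↦ (a ↦ F(a, ·))` as a linear isometry. -/
def l2CurryIsometry [IsSeparable ν] : Lp ℂ 2 (μ.prod ν) →ₗᵢ[ℂ] Lp (Lp ℂ 2 ν) 2 μ where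
  toFun F := (memLp_l2Section F).toLp _
  map_add' F G := by
    refine Lp.ext ?_
    filter_upwards [(memLp_l2Section (F + G)).coeFn_toLp, (memLp_l2Section F).coeFn_toLp,
      (memLp_l2Section G).coeFn_toLp, Lp.coeFn_add ((memLp_l2Section F).toLp _)
      ((memLp_l2Section G).toLp _), coeFn_l2Section F, coeFn_l2Section G,
      coeFn_l2Section (F + G), Measure.ae_ae_of_ae_prod (Lp.coeFn_add F G)]
      with a h1 h2 h3 h4 h5 h6 h7 h8
    rw [h1, h4, Pi.add_apply, h2, h3]
    refine Lp.ext ?_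
    filter_upwards [h5, h6, h7, h8, Lp.coeFn_add (l2Section F a) (l2Section G a)]
      with s h5 h6 h7 h8 h9
    rw [h7, h8, h9, Pi.add_apply, Pi.add_apply, h5, h6]
  map_smul' c F := by
    refine Lp.ext ?_
    filter_upwards [(memLp_l2Section (c • F)).coeFn_toLp, (memLp_l2Section F).coeFn_toLp,
      Lp.coeFn_smul c ((memLp_l2Section F).toLp _), coeFn_l2Section F,
      coeFn_l2Section (c • F), Measure.ae_ae_of_ae_prod (Lp.coeFn_smul c F)]
      with a h1 h2 h4 h5 h7 h8
    rw [h1, RingHom.id_apply, h4, Pi.smul_apply, h2]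
    refine Lp.ext ?_
    filter_upwards [h5, h7, h8, Lp.coeFn_smul c (l2Section F a)] with s h5 h7 h8 h9
    rw [h7, h8, h9, Pi.smul_apply, Pi.smul_apply, h5]
  norm_map' F := by
    have h : ‖(memLp_l2Section F).toLp _‖ₑ ^ 2 = ‖F‖ₑ ^ 2 := by
      rw [Lp.enorm_toLp, eLpNorm_two_sq, lintegral_l2Section]
    have h2 := (ENNReal.pow_right_strictMono two_ne_zero).injective h
    have h3 := congrArg ENNReal.toReal h2
    rwa [toReal_enorm, toReal_enorm] at h3

theorem coeFn_l2CurryIsometry [IsSeparable ν] (F : Lp ℂ 2 (μ.prod ν)) :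
    ∀ᵐ a ∂μ, l2CurryIsometry F a =ᵐ[ν] fun s => F (a, s) := by
  filter_upwards [(memLp_l2Section F).coeFn_toLp, coeFn_l2Section F] with a h1 h2
  refine Filter.EventuallyEq.trans ?_ h2
  exact (congrArg (fun G : Lp ℂ 2 ν => (G : β → ℂ)) h1).eventuallyEq

/-- Sections of a product function: the curried form of `f ⊗ g` is `a ↦ f(a) g`. -/
theorem l2CurryIsometry_mul [SFinite μ] [IsSeparable ν] {f : α → ℂ} (hf : MemLp f 2 μ)
    (G : Lp ℂ 2 ν) :
    l2CurryIsometry ((memLp_mul_prod hf (Lp.memLp G)).toLp _) =ᵐ[μ] fun a => f a • G := by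
  have h := Measure.ae_ae_of_ae_prod (memLp_mul_prod hf (Lp.memLp G)).coeFn_toLp
  filter_upwards [coeFn_l2CurryIsometry ((memLp_mul_prod hf (Lp.memLp G)).toLp _), h]
    with a h1 h2
  refine Lp.ext ?_
  filter_upwards [h1, h2, Lp.coeFn_smul (f a) G] with s h1 h2 h3
  rw [h1, h2, h3, Pi.smul_apply, smul_eq_mul]

theorem indicatorConst_eq_l2CurryIsometry [SFinite μ] [IsSeparable ν] (G : Lp ℂ 2 ν) {s : Set α}
    (hs : MeasurableSet s) (hμs : μ s < ∞) :
    (Lp.simpleFunc.indicatorConst 2 hs hμs.ne G : Lp (Lp ℂ 2 ν) 2 μ) =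
      l2CurryIsometry ((memLp_mul_prod (memLp_indicator_const 2 hs (1 : ℂ) (.inr hμs.ne))
        (Lp.memLp G)).toLp _) := by
  refine Lp.ext ?_
  rw [Lp.simpleFunc.coe_indicatorConst]
  filter_upwards [l2CurryIsometry_mul (memLp_indicator_const 2 hs (1 : ℂ) (.inr hμs.ne)) G,
    indicatorConstLp_coeFn (p := 2) (hs := hs) (hμs := hμs.ne) (c := G)] with a h1 h2
  rw [h1, h2]
  by_cases ha : a ∈ s <;> simp [ha]

/-- Simple functions with values in `L²(ν)` are dense, so a closed subspace of `L²(μ × ν)` with all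
products `1_s ⊗ G` is mapped onto `L²(μ; L²(ν))`; in particular `l2CurryIsometry` is surjective. -/
theorem mem_of_indicator_mul_mem [SFinite μ] [IsSeparable ν] (K : Submodule ℂ (Lp ℂ 2 (μ.prod ν)))
    (hK : IsClosed (K : Set (Lp ℂ 2 (μ.prod ν))))
    (h : ∀ (G : Lp ℂ 2 ν) (s : Set α) (hs : MeasurableSet s) (hμs : μ s < ∞),
      (memLp_mul_prod (memLp_indicator_const 2 hs (1 : ℂ) (.inr hμs.ne)) (Lp.memLp G)).toLp _ ∈ K) :
    ∀ T : Lp (Lp ℂ 2 ν) 2 μ, T ∈ K.map (l2CurryIsometry (μ := μ) (ν := ν)).toLinearMap := by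
  intro T
  refine Lp.induction (by norm_num) (motive := fun T : Lp (Lp ℂ 2 ν) 2 μ =>
    T ∈ K.map (l2CurryIsometry (μ := μ) (ν := ν)).toLinearMap) ?_ ?_ ?_ T
  · intro G s hs hμs
    rw [indicatorConst_eq_l2CurryIsometry G hs hμs]
    exact ⟨_, h G s hs hμs, rfl⟩
  · intro f g hf hg _ h1 h2
    exact add_mem h1 h2
  · have := (l2CurryIsometry (μ := μ) (ν := ν)).isometry.isClosedEmbedding.isClosedMap _ hK
    exact this

/-- A closed subspace of `L²(μ × ν)` containing all products `1_s ⊗ G` is everything. -/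
theorem eq_top_of_indicator_mul_mem [SFinite μ] [IsSeparable ν]
    (K : Submodule ℂ (Lp ℂ 2 (μ.prod ν))) (hK : IsClosed (K : Set (Lp ℂ 2 (μ.prod ν))))
    (h : ∀ (G : Lp ℂ 2 ν) (s : Set α) (hs : MeasurableSet s) (hμs : μ s < ∞),
      (memLp_mul_prod (memLp_indicator_const 2 hs (1 : ℂ) (.inr hμs.ne)) (Lp.memLp G)).toLp _ ∈ K) :
    K = ⊤ := by
  refine eq_top_iff.2 fun F _ => ?_
  obtain ⟨F', hF', h2⟩ := mem_of_indicator_mul_mem K hK h (l2CurryIsometry F)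
  rwa [← l2CurryIsometry.injective h2]

/-- The unitary identification `L²(μ × ν) ≅ L²(μ; L²(ν))`, `F ↦ (a ↦ F(a, ·))`. -/
def l2Curry (μ : Measure α) (ν : Measure β) [SFinite μ] [SFinite ν] [IsSeparable ν] :
    Lp ℂ 2 (μ.prod ν) ≃ₗᵢ[ℂ] Lp (Lp ℂ 2 ν) 2 μ :=
  LinearIsometryEquiv.ofSurjective l2CurryIsometry fun T => by
    obtain ⟨F, -, h⟩ := mem_of_indicator_mul_mem ⊤ isClosed_univ (fun _ _ _ _ => trivial) T
    exact ⟨F, h⟩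

theorem coeFn_l2Curry [SFinite μ] [IsSeparable ν] (F : Lp ℂ 2 (μ.prod ν)) :
    ∀ᵐ a ∂μ, l2Curry μ ν F a =ᵐ[ν] fun s => F (a, s) :=
  coeFn_l2CurryIsometry F

/-- A unitary map of Hilbert spaces acts fibrewise on square integrable vector valued functions. -/
def compLpEquiv {E F : Type*} [NormedAddCommGroup E] [InnerProductSpace ℂ E]
    [NormedAddCommGroup F] [InnerProductSpace ℂ F] (U : E ≃ₗᵢ[ℂ] F) (μ : Measure α) :
    Lp E 2 μ ≃ₗᵢ[ℂ] Lp F 2 μ where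
  toFun := (U : E →L[ℂ] F).compLpL 2 μ
  invFun := (U.symm : F →L[ℂ] E).compLpL 2 μ
  map_add' := map_add _
  map_smul' := map_smul _
  left_inv f := by
    refine Lp.ext ?_
    filter_upwards [(U.symm : F →L[ℂ] E).coeFn_compLpL (p := 2) (μ := μ)
      ((U : E →L[ℂ] F).compLpL 2 μ f), (U : E →L[ℂ] F).coeFn_compLpL (p := 2) (μ := μ) f]
      with a h1 h2
    rw [h1, h2]
    exact U.symm_apply_apply _
  right_inv f := by
    refine Lp.ext ?_
    filter_upwards [(U : E →L[ℂ] F).coeFn_compLpL (p := 2) (μ := μ)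
      ((U.symm : F →L[ℂ] E).compLpL 2 μ f), (U.symm : F →L[ℂ] E).coeFn_compLpL (p := 2) (μ := μ) f]
      with a h1 h2
    rw [h1, h2]
    exact U.apply_symm_apply _
  norm_map' f := by
    have h : ‖(U : E →L[ℂ] F).compLpL 2 μ f‖ₑ ^ 2 = ‖f‖ₑ ^ 2 := by
      rw [enorm_sq_eq_lintegral, enorm_sq_eq_lintegral]
      refine lintegral_congr_ae ?_
      filter_upwards [(U : E →L[ℂ] F).coeFn_compLpL (p := 2) (μ := μ) f] with a h
      rw [h]
      exact congrArg (· ^ 2) (U.enorm_map _)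
    have h2 := (ENNReal.pow_right_strictMono two_ne_zero).injective h
    have h3 := congrArg ENNReal.toReal h2
    rwa [toReal_enorm, toReal_enorm] at h3

theorem coeFn_compLpEquiv {E F : Type*} [NormedAddCommGroup E] [InnerProductSpace ℂ E]
    [NormedAddCommGroup F] [InnerProductSpace ℂ F] (U : E ≃ₗᵢ[ℂ] F) (f : Lp E 2 μ) :
    compLpEquiv U μ f =ᵐ[μ] fun a => U (f a) :=
  (U : E →L[ℂ] F).coeFn_compLpL f

end General

/-! ### The Fourier transform on `L¹ ∩ L²` -/

open FourierTransform in
/-- On `L¹ ∩ L²` the Fourier transform of `L²` is given by the Fourier integral: both have the same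
integrals against test functions, because both Fourier transforms are self-adjoint. -/
theorem coeFn_fourier_of_integrable {W : Type*} [NormedAddCommGroup W] [MeasurableSpace W]
    [BorelSpace W] [InnerProductSpace ℝ W] [FiniteDimensional ℝ W]
    (f : Lp ℂ 2 (volume : Measure W)) (hf : Integrable f) :
    Lp.fourierTransformₗᵢ W ℂ f =ᵐ[volume] 𝓕 (f : W → ℂ) := by
  have hc : Continuous (𝓕 (f : W → ℂ)) :=
    VectorFourier.fourierIntegral_continuous Real.continuous_fourierChar
      (by exact continuous_inner) hf
  refine ae_eq_of_integral_contDiff_smul_eq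
    ((Lp.memLp _).locallyIntegrable (by norm_num)) hc.locallyIntegrable ?_
  intro g g_smooth g_cpt
  have hg₁ : HasCompactSupport (Complex.ofRealCLM ∘ g) := g_cpt.comp_left rfl
  have hg₂ : ContDiff ℝ (⊤ : ℕ∞) (Complex.ofRealCLM ∘ g) := by fun_prop
  have h := congrArg (fun t => t (hg₁.toSchwartzMap hg₂)) (Lp.fourier_toTemperedDistribution_eq f)
  have h2 := VectorFourier.integral_fourierIntegral_smul_eq_flip (μ := volume) (ν := volume)
    (L := innerₗ W) (f := (hg₁.toSchwartzMap hg₂)) (g := f) Real.continuous_fourierChar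
    continuous_inner (hg₁.toSchwartzMap hg₂).integrable hf
  rw [flip_innerₗ] at h2
  simp only [TemperedDistribution.fourier_apply, Lp.toTemperedDistribution_apply] at h
  have h3 : ∫ x, g x • (Lp.fourierTransformₗᵢ W ℂ f) x =
      ∫ x, (hg₁.toSchwartzMap hg₂) x • (𝓕 f : Lp ℂ 2 (volume : Measure W)) x := by
    refine integral_congr_ae (.of_forall fun x => ?_)
    simp [FourierTransform.fourier]
  have h4 : ∫ x, g x • 𝓕 (f : W → ℂ) x = ∫ x, (hg₁.toSchwartzMap hg₂) x • 𝓕 (f : W → ℂ) x := by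
    refine integral_congr_ae (.of_forall fun x => ?_)
    simp
  rw [h3, h4, ← h]
  exact h2

namespace JHBasis

/-! ### Elementary tensors and Hilbert-Schmidt operators -/

section Tensor

variable {d : ℕ}

theorem coeFn_tensor (φ v : L2R d) :
    tensor φ v =ᵐ[volume] fun p => φ p.1 * conj (v p.2) :=
  (memLp_tensor φ v).coeFn_toLp

theorem coef_eq_inner (T : HS d) (φ ψ : L2R d) : coef T φ ψ = ⟪tensor ψ φ, T⟫_ℂ := by
  rw [coef, L2.inner_def]
  refine integral_congr_ae ?_
  filter_upwards [coeFn_tensor ψ φ] with p hp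
  rw [hp, RCLike.inner_apply, map_mul, Complex.conj_conj]
  ring

theorem inner_tensor_tensor (φ v ψ w : L2R d) :
    ⟪tensor φ v, tensor ψ w⟫_ℂ = ⟪φ, ψ⟫_ℂ * ⟪w, v⟫_ℂ := by
  rw [L2.inner_def, L2.inner_def, L2.inner_def, ← integral_prod_mul]
  refine integral_congr_ae ?_
  filter_upwards [coeFn_tensor φ v, coeFn_tensor ψ w] with p h1 h2
  simp only [h1, h2, RCLike.inner_apply, map_mul, Complex.conj_conj]
  ring

theorem tensor_add_right (φ v w : L2R d) : tensor φ (v + w) = tensor φ v + tensor φ w := by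
  refine Lp.ext ?_
  have h : ∀ᵐ p : (Fin d → ℝ) × (Fin d → ℝ), (v + w) p.2 = v p.2 + w p.2 :=
    Measure.quasiMeasurePreserving_snd.ae (Lp.coeFn_add v w)
  filter_upwards [coeFn_tensor φ (v + w), coeFn_tensor φ v, coeFn_tensor φ w, h,
    Lp.coeFn_add (tensor φ v) (tensor φ w)] with p h1 h2 h3 h4 h5
  rw [h1, h5, Pi.add_apply, h2, h3, h4, map_add, mul_add]

theorem tensor_zero_right (φ : L2R d) : tensor φ 0 = 0 := by
  have h := tensor_add_right φ 0 0
  simpa using h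

/-- The elementary tensors are total in the Hilbert-Schmidt operators. -/
theorem eq_zero_of_inner_tensor {T : HS d} (h : ∀ ψ v : L2R d, ⟪tensor ψ v, T⟫_ℂ = 0) : T = 0 := by
  have hK : (Submodule.span ℂ {T})ᗮ = ⊤ := eq_top_of_indicator_mul_mem
    (μ := (volume : Measure (Fin d → ℝ))) (ν := (volume : Measure (Fin d → ℝ)))
    (Submodule.span ℂ {T})ᗮ
    (Submodule.isClosed_orthogonal (Submodule.span ℂ {T}))
    fun G s hs hμs => by
      refine (Submodule.mem_orthogonal_singleton_iff_inner_left (𝕜 := ℂ) (E := HS d)).2 ?_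
      have key : ⟪_, T⟫_ℂ = 0 := h
        ((memLp_indicator_const 2 hs (1 : ℂ) (.inr hμs.ne)).toLp _) (star G)
      refine Eq.trans (congrArg (fun S : HS d => ⟪S, T⟫_ℂ) (Lp.ext ?_)) key
      have h1 : ∀ᵐ p : (Fin d → ℝ) × (Fin d → ℝ), (star G : L2R d) p.2 = (star (G : _ → ℂ)) p.2 :=
        Measure.quasiMeasurePreserving_snd.ae (Lp.coeFn_star G)
      have h2 : ∀ᵐ p : (Fin d → ℝ) × (Fin d → ℝ),
          ((memLp_indicator_const 2 hs (1 : ℂ) (.inr hμs.ne)).toLp _ : L2R d) p.1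
            = s.indicator (fun _ => (1 : ℂ)) p.1 :=
        Measure.quasiMeasurePreserving_fst.ae
          (memLp_indicator_const 2 hs (1 : ℂ) (.inr hμs.ne)).coeFn_toLp
      filter_upwards [(memLp_mul_prod (memLp_indicator_const 2 hs (1 : ℂ) (.inr hμs.ne))
        (Lp.memLp G)).coeFn_toLp, coeFn_tensor ((memLp_indicator_const 2 hs (1 : ℂ)
          (.inr hμs.ne)).toLp _) (star G), h1, h2] with p h3 h4 h1 h2
      rw [h3, h4, h2, h1]
      simp
  have hT : T ∈ (Submodule.span ℂ {T})ᗮ := by rw [hK]; trivial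
  simpa using (Submodule.mem_orthogonal_singleton_iff_inner_left.1 hT)

theorem eq_of_coef {S T : HS d} (h : ∀ φ ψ : L2R d, coef S φ ψ = coef T φ ψ) : S = T := by
  rw [← sub_eq_zero]
  refine eq_zero_of_inner_tensor fun ψ v => ?_
  rw [inner_sub_right, ← coef_eq_inner, ← coef_eq_inner, h, sub_self]

theorem tensor_mem_tensorSub {V : Submodule ℂ (L2R d)} (φ : L2R d) {v : L2R d} (hv : v ∈ V) :
    tensor φ v ∈ tensorSub V :=
  Submodule.le_topologicalClosure _ (Submodule.subset_span ⟨φ, v, hv, rfl⟩)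

theorem isClosed_tensorSub (V : Submodule ℂ (L2R d)) : IsClosed (tensorSub V : Set (HS d)) :=
  Submodule.isClosed_topologicalClosure _

theorem inner_tensor_of_mem_tensorSub {V : Submodule ℂ (L2R d)} {T : HS d} (hT : T ∈ tensorSub V)
    (ψ : L2R d) {v : L2R d} (hv : v ∈ Vᗮ) : ⟪tensor ψ v, T⟫_ℂ = 0 := by
  have h : tensorSub V ≤ (Submodule.span ℂ {tensor ψ v})ᗮ := by
    refine Submodule.topologicalClosure_minimal _ (Submodule.span_le.2 ?_)
      (Submodule.isClosed_orthogonal _)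
    rintro _ ⟨φ, w, hw, rfl⟩
    rw [SetLike.mem_coe, Submodule.mem_orthogonal_singleton_iff_inner_right, inner_tensor_tensor,
      (Submodule.mem_orthogonal V v).1 hv w hw, mul_zero]
  exact Submodule.mem_orthogonal_singleton_iff_inner_right.1 (h hT)

/-- `L²(ℝ^d) ⊗ V` consists of the operators that vanish on the orthogonal complement of `V`. -/
theorem mem_tensorSub_iff {V : Submodule ℂ (L2R d)} [V.HasOrthogonalProjection] {T : HS d} :
    T ∈ tensorSub V ↔ ∀ ψ, ∀ v ∈ Vᗮ, coef T v ψ = 0 := by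
  simp_rw [coef_eq_inner]
  refine ⟨fun hT ψ v hv => inner_tensor_of_mem_tensorSub hT ψ hv, fun h => ?_⟩
  have : CompleteSpace (tensorSub V) := (isClosed_tensorSub V).completeSpace_coe
  set S : HS d := (tensorSub V).starProjection T with hS
  have hS1 : S ∈ tensorSub V := Submodule.starProjection_apply_mem _ _
  have hS2 : T - S ∈ (tensorSub V)ᗮ := Submodule.sub_starProjection_mem_orthogonal _
  have h0 : T - S = 0 := by
    refine eq_zero_of_inner_tensor fun ψ v => ?_
    -- `T - S` is orthogonal to `ψ ⊗ v` for `v ∈ V` by projection, for `v ∈ Vᗮ` by hypothesis.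
    rw [← V.starProjection_add_starProjection_orthogonal v, tensor_add_right, inner_add_left]
    rw [(Submodule.mem_orthogonal _ _).1 hS2 _
      (tensor_mem_tensorSub ψ (Submodule.starProjection_apply_mem _ _)), zero_add,
      inner_sub_right, h ψ _ (Submodule.starProjection_apply_mem _ _),
      inner_tensor_of_mem_tensorSub hS1 ψ (Submodule.starProjection_apply_mem _ _), sub_zero]
  rw [sub_eq_zero.1 h0]
  exact hS1

end Tensor

/-! ### The Plancherel measure -/

variable {m d : ℕ} {𝔫 : Type*} [LieRing 𝔫] [LieAlgebra ℝ 𝔫] (J : JHBasis m d 𝔫)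

theorem dualZ_apply (l : Fin m → ℝ) (v : 𝔫) : J.dualZ l v = l ⬝ᵥ J.projZ v := by
  rw [dualZ, Module.Basis.constr_apply_fintype]
  simp [dotProduct, projZ, Fintype.sum_sum_type, mul_comm, Module.Basis.equivFun_apply]

theorem B_apply (l : Fin m → ℝ) (i j : Fin d) : J.B l i j = l ⬝ᵥ J.projZ ⁅J.X i, J.Y j⁆ := by
  rw [B, Matrix.of_apply, dualZ_apply]

theorem B_add (l l' : Fin m → ℝ) : J.B (l + l') = J.B l + J.B l' := by
  ext i j; simp [B_apply, add_dotProduct]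

theorem B_smul (r : ℝ) (l : Fin m → ℝ) : J.B (r • l) = r • J.B l := by
  ext i j; simp [B_apply, smul_dotProduct]

theorem continuous_B : Continuous J.B := by
  refine continuous_matrix fun i j => ?_
  simp only [B_apply, dotProduct]
  fun_prop

theorem measurableSet_sig : MeasurableSet J.sig :=
  (isOpen_ne_fun J.continuous_B.matrix_det continuous_const).measurableSet

theorem exists_mem_sig : ∃ l, l ∈ J.sig := by
  obtain ⟨l, hl⟩ := J.det_ne_zero
  refine ⟨fun k => l (J.Z k), ?_⟩
  convert hl using 3
  ext i j
  rw [B_apply]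
  conv_rhs => rw [Matrix.of_apply, ← J.linZ_projZ_of_mem (J.lie_X_Y i j)]
  simp only [dotProduct, linZ, Fintype.linearCombination_apply, map_sum, map_smul, smul_eq_mul]
  exact Finset.sum_congr rfl fun k _ => mul_comm _ _

/-- The complement of `Σ`, the zero set of the non-zero polynomial `det B`, is a null set: it meets
each line parallel to a fixed vector of `Σ` in a finite set. -/
theorem ae_mem_sig : ∀ᵐ l : Fin m → ℝ, l ∈ J.sig := by
  obtain ⟨l₀, h₀⟩ := J.exists_mem_sig
  have hfin (l : Fin m → ℝ) : ∀ᵐ t : ℝ, l + t • l₀ ∈ J.sig := by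
    set p : Polynomial ℝ := Matrix.det ((Polynomial.X : Polynomial ℝ) •
      (J.B l₀).map Polynomial.C + (J.B l).map Polynomial.C) with hp
    have hp0 : p ≠ 0 := fun h => h₀ (by
      rw [← Polynomial.coeff_det_X_add_C_card (J.B l₀) (J.B l), ← hp, h, Polynomial.coeff_zero])
    have heval (t : ℝ) : p.eval t = (J.B (l + t • l₀)).det := by
      rw [hp, ← Polynomial.coe_evalRingHom, RingHom.map_det, B_add, B_smul]
      congr 1
      ext i j
      simp [add_comm, mul_comm t]
    have hs : {t : ℝ | ¬ (l + t • l₀ ∈ J.sig)} ⊆ (p.roots.toFinset : Set ℝ) := by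
      intro t ht
      have : (J.B (l + t • l₀)).det = 0 := not_not.1 ht
      simp [hp0, heval, this]
    exact measure_mono_null hs (Finset.measure_zero _ _)
  have hmeas : MeasurableSet {q : (Fin m → ℝ) × ℝ | q.1 + q.2 • l₀ ∈ J.sig} :=
    J.measurableSet_sig.preimage (by fun_prop)
  have h1 : ∀ᵐ q : (Fin m → ℝ) × ℝ, q.1 + q.2 • l₀ ∈ J.sig :=
    (Measure.ae_prod_iff_ae_ae hmeas).2 (.of_forall hfin)
  have h2 : ∀ᵐ q : ℝ × (Fin m → ℝ), q.2 + q.1 • l₀ ∈ J.sig :=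
    Measure.measurePreserving_swap.quasiMeasurePreserving.ae h1
  obtain ⟨t, ht⟩ := (Measure.ae_ae_of_ae_prod h2).exists
  have h3 := (measurePreserving_sub_right (volume : Measure (Fin m → ℝ))
    (t • l₀)).quasiMeasurePreserving.ae ht
  filter_upwards [h3] with l hl
  simpa using hl

theorem planch_eq : J.planch = volume.withDensity fun l => ENNReal.ofReal |(J.B l).det| := by
  rw [planch, Measure.restrict_eq_self_of_ae_mem J.ae_mem_sig]

theorem measurable_abs_det : Measurable fun l => ENNReal.ofReal |(J.B l).det| :=
  (J.continuous_B.matrix_det.abs.measurable).ennreal_ofReal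

/-- The Plancherel measure has the same null sets as Lebesgue measure. -/
theorem ae_planch : ae J.planch = ae volume := by
  rw [planch_eq]
  refine le_antisymm (withDensity_absolutelyContinuous _ _).ae_le
    (withDensity_absolutelyContinuous' J.measurable_abs_det.aemeasurable ?_).ae_le
  filter_upwards [J.ae_mem_sig] with l hl
  simpa [ENNReal.ofReal_eq_zero] using! hl

theorem ae_planch_mem_sig : ∀ᵐ l ∂J.planch, l ∈ J.sig := by
  rw [ae_planch]; exact J.ae_mem_sig

theorem ae_planch_smul {r : ℝ} (hr : r ≠ 0) {p : (Fin m → ℝ) → Prop} (h : ∀ᵐ l ∂J.planch, p l) :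
    ∀ᵐ l ∂J.planch, p (r • l) := by
  rw [ae_planch] at h ⊢
  have : Measure.QuasiMeasurePreserving (fun l : Fin m → ℝ => r • l) volume volume := by
    refine ⟨measurable_const_smul r, ?_⟩
    rw [Measure.map_addHaar_smul _ hr]
    exact Measure.smul_absolutelyContinuous
  exact this.ae h

instance sFinite_planch : SFinite J.planch := by rw [planch_eq]; infer_instance

theorem lintegral_planch {h : (Fin m → ℝ) → ℝ≥0∞} (hh : Measurable h) :
    ∫⁻ l, h l ∂J.planch = ∫⁻ l, ENNReal.ofReal |(J.B l).det| * h l := by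
  rw [planch_eq, lintegral_withDensity_eq_lintegral_mul _ J.measurable_abs_det hh]
  rfl

/-! ### The Plancherel transform as an explicit unitary map -/

/-- `ℝ^m × ℝ^d` with its Euclidean inner product. -/
abbrev ZYSpace (m d : ℕ) : Type := EuclideanSpace ℝ (Fin m ⊕ Fin d)

/-- The point `(z, y)` of `ℝ^m × ℝ^d`. -/
def zyEquiv (m d : ℕ) : (Fin m → ℝ) × (Fin d → ℝ) ≃ᵐ ZYSpace m d :=
  (MeasurableEquiv.sumPiEquivProdPi fun _ => ℝ).symm.trans (MeasurableEquiv.toLp 2 _)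

theorem measurePreserving_zyEquiv (m d : ℕ) : MeasurePreserving (zyEquiv m d) volume volume :=
  (PiLp.volume_preserving_toLp _).comp
    (volume_measurePreserving_sumPiEquivProdPi_symm fun _ : Fin m ⊕ Fin d => ℝ)

theorem inner_zyEquiv {m d : ℕ} (z z' : Fin m → ℝ) (y y' : Fin d → ℝ) :
    ⟪zyEquiv m d (z, y), zyEquiv m d (z', y')⟫_ℝ = z ⬝ᵥ z' + y ⬝ᵥ y' := by
  have h1 (z : Fin m → ℝ) (y : Fin d → ℝ) (i) : zyEquiv m d (z, y) (.inl i) = z i := rfl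
  have h2 (z : Fin m → ℝ) (y : Fin d → ℝ) (i) : zyEquiv m d (z, y) (.inr i) = y i := rfl
  simp [PiLp.inner_apply, Fintype.sum_sum_type, h1, h2, dotProduct, mul_comm]

section PartialFourier

open FourierTransform

variable {α W : Type*} [MeasurableSpace α] (μ : Measure α) [SFinite μ] [NormedAddCommGroup W]
  [MeasurableSpace W] [BorelSpace W] [InnerProductSpace ℝ W] [FiniteDimensional ℝ W]

/-- The Fourier transform in the second variable, as a unitary map of `L²(α × W)`. -/
def partialFourier : Lp ℂ 2 (μ.prod (volume : Measure W)) ≃ₗᵢ[ℂ]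
    Lp ℂ 2 (μ.prod (volume : Measure W)) :=
  ((l2Curry μ volume).trans (compLpEquiv (Lp.fourierTransformₗᵢ W ℂ) μ)).trans
    (l2Curry μ volume).symm

theorem coeFn_partialFourier (F : Lp ℂ 2 (μ.prod (volume : Measure W)))
    (hF : Integrable F (μ.prod volume)) :
    partialFourier μ F =ᵐ[μ.prod volume] fun p => 𝓕 (fun w => F (p.1, w)) p.2 := by
  have hm : MeasurableSet {p : α × W | partialFourier μ F p = 𝓕 (fun w => F (p.1, w)) p.2} := by
    refine measurableSet_eq_fun (Lp.stronglyMeasurable _).measurable ?_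
    have hFm := Lp.stronglyMeasurable F
    refine StronglyMeasurable.measurable ?_
    simp only [Real.fourier_eq]
    refine StronglyMeasurable.integral_prod_right' (f := fun q : (α × W) × W =>
      Real.fourierChar (-⟪q.2, q.1.2⟫_ℝ) • F (q.1.1, q.2)) ?_
    refine StronglyMeasurable.fun_smul ?_ (hFm.comp_measurable (by fun_prop))
    exact Real.continuous_fourierChar.stronglyMeasurable.comp_measurable (by fun_prop)
  refine (Measure.ae_prod_iff_ae_ae hm).2 ?_
  have e : l2Curry μ volume (partialFourier μ F) =
      compLpEquiv (Lp.fourierTransformₗᵢ W ℂ) μ (l2Curry μ volume F) := by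
    simp [partialFourier]
  have h1 := coeFn_l2Curry (partialFourier μ F)
  rw [e] at h1
  filter_upwards [h1, coeFn_compLpEquiv (Lp.fourierTransformₗᵢ W ℂ) (l2Curry μ volume F),
    coeFn_l2Curry F, hF.prod_right_ae] with a h1 h2 h3 h4
  rw [h2] at h1
  filter_upwards [h1, coeFn_fourier_of_integrable _ (h4.congr h3.symm)] with w h1 h5
  rw [← h1, h5, Real.fourier_eq, Real.fourier_eq]
  refine integral_congr_ae ?_
  filter_upwards [h3] with v h3
  rw [h3]

end PartialFourier

/-- The group element with coordinates `(z, y, x)`, as a function of `x` and `(z, y)`. -/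
def toGrp (q : (Fin d → ℝ) × ZYSpace m d) : J.Grp :=
  J.coords.symm (((zyEquiv m d).symm q.2).1, ((zyEquiv m d).symm q.2).2, q.1)

/-- The inverse of `toGrp`. -/
def ofGrp (g : J.Grp) : (Fin d → ℝ) × ZYSpace m d :=
  ((J.coords g).2.2, zyEquiv m d ((J.coords g).1, (J.coords g).2.1))

theorem measurePreserving_toGrp : MeasurePreserving J.toGrp (volume.prod volume) J.haar := by
  have h1 := (MeasurePreserving.id (volume : Measure (Fin d → ℝ))).prod
    (measurePreserving_zyEquiv m d).symm
  have h2 := (Measure.measurePreserving_swap (μ := (volume : Measure (Fin d → ℝ)))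
    (ν := (volume : Measure ((Fin m → ℝ) × (Fin d → ℝ)))))
  have h3 := measurePreserving_prodAssoc (volume : Measure (Fin m → ℝ))
    (volume : Measure (Fin d → ℝ)) (volume : Measure (Fin d → ℝ))
  exact J.measurePreserving_coords_symm.comp (h3.comp (h2.comp h1))

theorem measurable_ofGrp : Measurable J.ofGrp := by
  unfold ofGrp
  fun_prop

theorem ofGrp_toGrp (q : (Fin d → ℝ) × ZYSpace m d) : J.ofGrp (J.toGrp q) = q := by
  simp [ofGrp, toGrp]

theorem toGrp_ofGrp (g : J.Grp) : J.toGrp (J.ofGrp g) = g := by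
  simp [ofGrp, toGrp]

/-- The change of variables `(λ, t, s) ↦ (t - s, (-λ, B(λ)ᵀ t))` relating the kernel of the operator
valued Fourier transform to the partial Fourier transform in `(z, y)`. -/
def kernelMap (p : (Fin m → ℝ) × (Fin d → ℝ) × (Fin d → ℝ)) : (Fin d → ℝ) × ZYSpace m d :=
  (p.2.1 - p.2.2, zyEquiv m d (-p.1, (J.B p.1).transpose.mulVec p.2.1))

/-- The inverse of `kernelMap` over `Σ`. -/
def kernelInv (q : (Fin d → ℝ) × ZYSpace m d) : (Fin m → ℝ) × (Fin d → ℝ) × (Fin d → ℝ) :=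
  let l := -((zyEquiv m d).symm q.2).1
  let t := (J.B l).transpose.det⁻¹ • (J.B l).transpose.adjugate.mulVec ((zyEquiv m d).symm q.2).2
  (l, t, t - q.1)

theorem continuous_mulVec_B : Continuous fun p : (Fin m → ℝ) × (Fin d → ℝ) =>
    (J.B p.1).transpose.mulVec p.2 :=
  (J.continuous_B.comp continuous_fst).matrix_transpose.matrix_mulVec continuous_snd

theorem measurable_kernelMap : Measurable J.kernelMap := by
  have h := J.continuous_mulVec_B.measurable
  refine Measurable.prodMk (by fun_prop) ((zyEquiv m d).measurable.comp ?_)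
  exact Measurable.prodMk (by fun_prop)
    (h.comp (g := fun p : (Fin m → ℝ) × (Fin d → ℝ) => (J.B p.1).transpose.mulVec p.2)
      (f := fun p : (Fin m → ℝ) × (Fin d → ℝ) × (Fin d → ℝ) => (p.1, p.2.1)) (by fun_prop))

theorem measurable_kernelInv : Measurable J.kernelInv := by
  have h1 : Measurable fun q : (Fin d → ℝ) × ZYSpace m d => -((zyEquiv m d).symm q.2).1 := by
    fun_prop
  have h2 : Measurable fun q : (Fin d → ℝ) × ZYSpace m d => ((zyEquiv m d).symm q.2).2 := by
    fun_prop
  have hd : Measurable fun l : Fin m → ℝ => (J.B l).transpose.det⁻¹ :=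
    J.continuous_B.matrix_transpose.matrix_det.measurable.inv
  have ha : Continuous fun p : (Fin m → ℝ) × (Fin d → ℝ) =>
      (J.B p.1).transpose.adjugate.mulVec p.2 :=
    (J.continuous_B.comp continuous_fst).matrix_transpose.matrix_adjugate.matrix_mulVec
      continuous_snd
  have h3 := (hd.comp h1).smul (ha.measurable.comp (h1.prodMk h2))
  exact h1.prodMk (h3.prodMk (h3.sub measurable_fst))

theorem kernelInv_kernelMap {p : (Fin m → ℝ) × (Fin d → ℝ) × (Fin d → ℝ)} (hp : p.1 ∈ J.sig) :
    J.kernelInv (J.kernelMap p) = p := by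
  have hp' : (J.B p.1).transpose.det ≠ 0 := by rwa [Matrix.det_transpose]
  obtain ⟨l, t, s⟩ := p
  simp only [kernelInv, kernelMap, MeasurableEquiv.symm_apply_apply, neg_neg, Matrix.mulVec_mulVec,
    Matrix.adjugate_mul, Matrix.smul_mulVec, smul_smul]
  simp only at hp'
  rw [inv_mul_cancel₀ hp']
  simp

theorem lintegral_mulVec {M : Matrix (Fin d) (Fin d) ℝ} (hM : M.det ≠ 0)
    {h : (Fin d → ℝ) → ℝ≥0∞} (hh : Measurable h) :
    ENNReal.ofReal |M.det| * ∫⁻ t, h (M.mulVec t) = ∫⁻ t, h t := by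
  have hl : Measurable (Matrix.toLin' M) :=
    (LinearMap.continuous_of_finiteDimensional (Matrix.toLin' M)).measurable
  have h1 := lintegral_map (μ := volume) hh hl
  rw [Real.map_matrix_volume_pi_eq_smul_volume_pi hM, lintegral_smul_measure] at h1
  have h2 : ∫⁻ t, h (M.mulVec t) = ∫⁻ t, h (Matrix.toLin' M t) := rfl
  rw [h2, ← h1, smul_eq_mul, ← mul_assoc, ← ENNReal.ofReal_mul (abs_nonneg _), ← abs_mul,
    mul_inv_cancel₀ hM]
  simp

/-- `kernelMap` takes the Plancherel measure times Lebesgue measure to Lebesgue measure, because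
`t ↦ B(λ)ᵀ t` scales Lebesgue measure by `|det B(λ)|⁻¹`. -/
theorem measurePreserving_kernelMap : MeasurePreserving J.kernelMap
    (J.planch.prod (volume.prod volume)) (volume.prod volume) := by
  refine ⟨J.measurable_kernelMap, Measure.ext_of_lintegral _ fun h hh => ?_⟩
  have hm : Measurable fun p => h (J.kernelMap p) := hh.comp J.measurable_kernelMap
  rw [lintegral_map hh J.measurable_kernelMap, lintegral_prod _ hm.aemeasurable,
    lintegral_planch _ hm.lintegral_prod_right']
  let k : (Fin m → ℝ) → (Fin d → ℝ) → ℝ≥0∞ := fun l y => ∫⁻ x, h (x, zyEquiv m d (l, y))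
  have hk : Measurable fun p : (Fin m → ℝ) × (Fin d → ℝ) => k p.1 p.2 :=
    Measurable.lintegral_prod_right (f := fun (p : (Fin m → ℝ) × (Fin d → ℝ)) x =>
      h (x, zyEquiv m d (p.1, p.2))) (by fun_prop)
  have key : ∀ᵐ l : Fin m → ℝ, ENNReal.ofReal |(J.B l).det| *
      ∫⁻ b : (Fin d → ℝ) × (Fin d → ℝ), h (J.kernelMap (l, b)) ∂(volume.prod volume) =
      ∫⁻ y, k (-l) y := by
    filter_upwards [J.ae_mem_sig] with l hl
    have hl' : (J.B l).transpose.det ≠ 0 := by rwa [Matrix.det_transpose]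
    rw [lintegral_prod (fun b => h (J.kernelMap (l, b)))
      (hm.comp measurable_prodMk_left).aemeasurable, ← lintegral_mulVec hl' (h := k (-l))
      (hk.comp measurable_prodMk_left), Matrix.det_transpose]
    congr 1
    refine lintegral_congr fun t => ?_
    exact lintegral_sub_left_eq_self (μ := (volume : Measure (Fin d → ℝ))) (fun x =>
      h (x, zyEquiv m d (-l, (J.B l).transpose.mulVec t))) t
  rw [lintegral_congr_ae key, lintegral_neg_eq_self (fun l => ∫⁻ y, k l y),
    lintegral_prod_symm' _ hh, ← (measurePreserving_zyEquiv m d).lintegral_comp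
      hh.lintegral_prod_left', Measure.volume_eq_prod, lintegral_prod _ hk.aemeasurable]

/-- Functions on `N` as functions of `x` and `(z, y)`. -/
def coordUnitary :
    J.L2N ≃ₗᵢ[ℂ] Lp ℂ 2 ((volume : Measure (Fin d → ℝ)).prod (volume : Measure (ZYSpace m d))) :=
  l2Congr J.toGrp J.ofGrp J.measurePreserving_toGrp J.measurable_ofGrp (.of_forall J.ofGrp_toGrp)

theorem coeFn_coordUnitary (f : J.L2N) :
    J.coordUnitary f =ᵐ[volume.prod volume] fun q => f (J.toGrp q) :=
  coeFn_l2Congr _ _ _ _ _ f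

/-- Composition with `kernelMap`; it is onto because `Σ` has full measure. -/
def kernelUnitary :
    Lp ℂ 2 ((volume : Measure (Fin d → ℝ)).prod (volume : Measure (ZYSpace m d))) ≃ₗᵢ[ℂ]
      Lp ℂ 2 (J.planch.prod
        ((volume : Measure (Fin d → ℝ)).prod (volume : Measure (Fin d → ℝ)))) :=
  l2Congr J.kernelMap J.kernelInv J.measurePreserving_kernelMap J.measurable_kernelInv
    ((Measure.quasiMeasurePreserving_fst.ae J.ae_planch_mem_sig).mono
      fun _ hp => J.kernelInv_kernelMap hp)

theorem coeFn_kernelUnitary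
    (F : Lp ℂ 2 ((volume : Measure (Fin d → ℝ)).prod (volume : Measure (ZYSpace m d)))) :
    J.kernelUnitary F =ᵐ[J.planch.prod (volume.prod volume)] fun p => F (J.kernelMap p) :=
  coeFn_l2Congr _ _ _ _ _ F

/-- The Plancherel transform: the kernel of the operator at `λ` is
`(t, s) ↦ (ℱf)(t - s, (-λ, B(λ)ᵀ t))`, where `ℱ` is the Fourier transform in `(z, y)`. -/
def plancherel : J.L2N ≃ₗᵢ[ℂ] J.DirInt :=
  ((J.coordUnitary.trans (partialFourier volume)).trans J.kernelUnitary).trans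
    (l2Curry J.planch (volume.prod volume))

/-! ### The Plancherel transform extends the Fourier transform -/

theorem coeFn_plancherel (f : J.L2N) : ∀ᵐ l ∂J.planch, ∀ᵐ p ∂(volume.prod volume),
    J.plancherel f l p = partialFourier volume (J.coordUnitary f) (J.kernelMap (l, p)) := by
  filter_upwards [coeFn_l2Curry (J.kernelUnitary (partialFourier volume (J.coordUnitary f))),
    Measure.ae_ae_of_ae_prod (J.coeFn_kernelUnitary (partialFourier volume (J.coordUnitary f)))]
    with l h2 h3
  filter_upwards [h2, h3] with p h2 h3
  rw [← h3, ← h2]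
  rfl

theorem coeFn_plancherel_of_integrable (f : J.L2N) (hf : Integrable f J.haar) :
    ∀ᵐ l ∂J.planch, ∀ᵐ p ∂(volume.prod volume), J.plancherel f l p =
      ∫ w, Real.fourierChar (-⟪w, (J.kernelMap (l, p)).2⟫_ℝ) •
        f (J.toGrp ((J.kernelMap (l, p)).1, w)) := by
  set F := J.coordUnitary f with hF
  have h1 : F =ᵐ[volume.prod volume] fun q => f (J.toGrp q) := J.coeFn_coordUnitary f
  have hFi : Integrable F (volume.prod volume) :=
    (J.measurePreserving_toGrp.integrable_comp_of_integrable hf).congr h1.symm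
  have h2 : partialFourier volume F =ᵐ[volume.prod volume] fun q =>
      ∫ w, Real.fourierChar (-⟪w, q.2⟫_ℝ) • f (J.toGrp (q.1, w)) := by
    have h4 := Measure.quasiMeasurePreserving_fst
      (ν := (volume : Measure (ZYSpace m d))).ae (Measure.ae_ae_of_ae_prod h1)
    filter_upwards [coeFn_partialFourier volume F hFi, h4] with q h3 h4
    rw [h3, Real.fourier_eq]
    refine integral_congr_ae ?_
    filter_upwards [h4] with w h4
    rw [h4]
  filter_upwards [J.coeFn_plancherel f, Measure.ae_ae_of_ae_prod
    (J.measurePreserving_kernelMap.quasiMeasurePreserving.ae h2)] with l h3 h4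
  filter_upwards [h3, h4] with p h3 h4
  rw [h3, h4]

theorem norm_phase (l : Fin m → ℝ) (g : J.Grp) (t : Fin d → ℝ) : ‖J.phase l g t‖ = 1 := by
  rw [phase, mul_right_comm, ← Complex.norm_exp_ofReal_mul_I (2 * Real.pi *
    (l ⬝ᵥ (J.coords g).1 - t ⬝ᵥ (J.B l).mulVec (J.coords g).2.1))]
  push_cast
  rfl

theorem measurable_phase (l : Fin m → ℝ) :
    Measurable fun p : (Fin d → ℝ) × J.Grp => J.phase l p.2 p.1 := by
  unfold phase dotProduct Matrix.mulVec dotProduct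
  fun_prop

theorem coords_toGrp (q : (Fin d → ℝ) × ZYSpace m d) : J.coords (J.toGrp q) =
    (((zyEquiv m d).symm q.2).1, ((zyEquiv m d).symm q.2).2, q.1) := by
  simp [toGrp]

/-- The character of the partial Fourier transform at the frequency `(-λ, B(λ)ᵀ t)` is the phase of
`π_λ` at `t`. -/
theorem fourierChar_kernelMap (l : Fin m → ℝ) (t s x : Fin d → ℝ) (w : ZYSpace m d) :
    (Real.fourierChar (-⟪w, (J.kernelMap (l, t, s)).2⟫_ℝ) : ℂ) = J.phase l (J.toGrp (x, w)) t := by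
  obtain ⟨⟨z, y⟩, rfl⟩ := (zyEquiv m d).surjective w
  rw [Real.fourierChar_apply, phase, coords_toGrp, kernelMap, inner_zyEquiv]
  simp only [MeasurableEquiv.symm_apply_apply]
  congr 1
  rw [dotProduct_neg, Matrix.mulVec_transpose, dotProduct_comm y,
    ← Matrix.dotProduct_mulVec, dotProduct_comm z l]
  push_cast
  ring

theorem coeFn_rep (l : Fin m → ℝ) (g : J.Grp) (φ : L2R d) :
    J.rep l g φ =ᵐ[volume] fun t => J.phase l g t * φ (t - (J.coords g).2.2) :=
  (J.memLp_rep l g φ).coeFn_toLp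

theorem inner_rep (l : Fin m → ℝ) (g : J.Grp) (φ ψ : L2R d) : ⟪ψ, J.rep l g φ⟫_ℂ =
    ∫ t, J.phase l g t * φ (t - (J.coords g).2.2) * conj (ψ t) := by
  rw [L2.inner_def]
  refine integral_congr_ae ?_
  filter_upwards [J.coeFn_rep l g φ] with t h
  rw [h, RCLike.inner_apply]

instance sFinite_haar : SFinite J.haar := by
  unfold haar
  infer_instance

/-- The integrand of the matrix coefficient of `ℱf(λ)` is jointly integrable. -/
theorem integrable_coef_integrand (f : J.L2N) (hf : Integrable f J.haar) (l : Fin m → ℝ)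
    (φ ψ : L2R d) : Integrable (fun p : (Fin d → ℝ) × J.Grp =>
      f p.2 * (J.phase l p.2 p.1 * φ (p.1 - (J.coords p.2).2.2) * conj (ψ p.1)))
      (volume.prod J.haar) := by
  have hfm := (Lp.stronglyMeasurable f).measurable
  have hφ := (Lp.stronglyMeasurable φ).measurable
  have hψ := (Lp.stronglyMeasurable ψ).measurable
  have hph := J.measurable_phase l
  have hm : Measurable (fun p : (Fin d → ℝ) × J.Grp =>
      f p.2 * (J.phase l p.2 p.1 * φ (p.1 - (J.coords p.2).2.2) * conj (ψ p.1))) := by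
    have : Measurable fun p : (Fin d → ℝ) × J.Grp => conj (ψ p.1) :=
      Complex.continuous_conj.measurable.comp (hψ.comp measurable_fst)
    exact (hfm.comp measurable_snd).mul
      ((hph.mul (hφ.comp (by fun_prop))).mul this)
  have hφ2 : Integrable (fun t => ‖φ t‖ ^ 2) :=
    (Lp.memLp φ).integrable_norm_pow (p := 2) (by norm_num)
  have hψ2 : Integrable (fun t => ‖ψ t‖ ^ 2) :=
    (Lp.memLp ψ).integrable_norm_pow (p := 2) (by norm_num)
  have hb (g : J.Grp) : Integrable fun t =>
      ‖φ (t - (J.coords g).2.2)‖ ^ 2 + ‖ψ t‖ ^ 2 :=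
    (hφ2.comp_sub_right (J.coords g).2.2).add hψ2
  have hle (g : J.Grp) (t : Fin d → ℝ) :
      ‖f g * (J.phase l g t * φ (t - (J.coords g).2.2) * conj (ψ t))‖ ≤
        ‖f g‖ * (‖φ (t - (J.coords g).2.2)‖ ^ 2 + ‖ψ t‖ ^ 2) := by
    rw [norm_mul, norm_mul, norm_mul, norm_phase, one_mul, RCLike.norm_conj]
    gcongr
    nlinarith [sq_nonneg (‖φ (t - (J.coords g).2.2)‖ - ‖ψ t‖),
      norm_nonneg (φ (t - (J.coords g).2.2)), norm_nonneg (ψ t), sq_nonneg ‖ψ t‖,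
      sq_nonneg ‖φ (t - (J.coords g).2.2)‖]
  -- The `t`-integral is bounded by `‖f g‖ (‖φ‖² + ‖ψ‖²)`, which is integrable in `g`.
  refine (integrable_prod_iff' hm.aestronglyMeasurable).2 ⟨.of_forall fun g => ?_, ?_⟩
  · exact ((hb g).const_mul _).mono' (hm.comp measurable_prodMk_right).aestronglyMeasurable
      (.of_forall fun t => hle g t)
  · refine (hf.norm.mul_const ((∫ t, ‖φ t‖ ^ 2) + ∫ t, ‖ψ t‖ ^ 2)).mono'
      (hm.aestronglyMeasurable.norm.prod_swap.integral_prod_right') (.of_forall fun g => ?_)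
    rw [Real.norm_of_nonneg (integral_nonneg fun _ => norm_nonneg _)]
    refine (integral_mono_of_nonneg (.of_forall fun _ => norm_nonneg _)
      ((hb g).const_mul _) (.of_forall fun t => hle g t)).trans_eq ?_
    rw [integral_const_mul, integral_add (hφ2.comp_sub_right _) hψ2,
      integral_sub_right_eq_self (fun t => ‖φ t‖ ^ 2)]

/-- On `L¹ ∩ L²`, `plancherel` is the operator valued Fourier transform: write the matrix
coefficient as an integral over `(t, s)`, substitute `s = t - x` and exchange the integrals. -/
theorem isFourier_plancherel (f : J.L2N) (hf : Integrable f J.haar) :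
    J.IsFourier f (J.plancherel f) := by
  refine ⟨hf, ?_⟩
  filter_upwards [J.coeFn_plancherel_of_integrable f hf] with l hl φ ψ
  let K : (Fin d → ℝ) × (Fin d → ℝ) → ℂ := fun p =>
    ∫ w, J.phase l (J.toGrp (p.1 - p.2, w)) p.1 * f (J.toGrp (p.1 - p.2, w))
  have hK : J.plancherel f l =ᵐ[volume.prod volume] K := by
    filter_upwards [hl] with p hp
    rw [hp]
    refine integral_congr_ae (.of_forall fun w => ?_)
    change _ = J.phase l (J.toGrp (p.1 - p.2, w)) p.1 * f (J.toGrp (p.1 - p.2, w))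
    rw [← J.fourierChar_kernelMap l p.1 p.2]
    rfl
  have hint : Integrable (fun p => K p * φ p.2 * conj (ψ p.1)) (volume.prod volume) := by
    refine (L2.integrable_inner (𝕜 := ℂ) (tensor ψ φ) (J.plancherel f l)).congr ?_
    filter_upwards [hK, coeFn_tensor ψ φ] with p h1 h2
    rw [h1, h2, RCLike.inner_apply, map_mul, Complex.conj_conj]
    ring
  let Φ : (Fin d → ℝ) × J.Grp → ℂ := fun p =>
    f p.2 * (J.phase l p.2 p.1 * φ (p.1 - (J.coords p.2).2.2) * conj (ψ p.1))
  have hΦ : Integrable Φ (volume.prod J.haar) := J.integrable_coef_integrand f hf l φ ψ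
  have hemb : MeasurableEmbedding J.toGrp :=
    MeasurableEquiv.measurableEmbedding ⟨⟨J.toGrp, J.ofGrp, J.ofGrp_toGrp, J.toGrp_ofGrp⟩,
      J.measurePreserving_toGrp.measurable, J.measurable_ofGrp⟩
  have hLHS : coef (J.plancherel f l) φ ψ =
      ∫ p, K p * φ p.2 * conj (ψ p.1) ∂(volume.prod volume) := by
    refine integral_congr_ae ?_
    filter_upwards [hK] with p hp
    rw [hp]
  rw [hLHS, integral_prod _ hint]
  -- The substitution `s = t - x`, for fixed `t`.
  have h1 : ∀ᵐ t : Fin d → ℝ, ∫ s, K (t, s) * φ s * conj (ψ t) = ∫ g, Φ (t, g) ∂J.haar := by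
    filter_upwards [hΦ.prod_right_ae] with t ht
    rw [← J.measurePreserving_toGrp.integral_comp hemb, integral_prod (fun q => Φ (t, J.toGrp q))
      (J.measurePreserving_toGrp.integrable_comp_of_integrable ht),
      ← integral_sub_left_eq_self _ volume t]
    refine integral_congr_ae (.of_forall fun x => ?_)
    simp only [K, Φ, coords_toGrp, sub_sub_cancel]
    rw [mul_assoc, ← integral_mul_const]
    refine integral_congr_ae (.of_forall fun w => ?_)
    ring
  rw [integral_congr_ae h1, ← integral_prod _ hΦ, integral_prod_symm _ hΦ]
  refine integral_congr_ae (.of_forall fun g => ?_)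
  simp only [Φ]
  rw [integral_const_mul, inner_rep]

theorem IsFourier.eq_plancherel {f : J.L2N} {T : J.DirInt} (h : J.IsFourier f T) :
    T = J.plancherel f := by
  refine Lp.ext ?_
  filter_upwards [h.2, (J.isFourier_plancherel f h.1).2] with l h1 h2
  exact eq_of_coef fun φ ψ => by rw [h1, h2]

/-- To prove a closed condition on `L²(N)` it suffices to prove it on `L¹(N) ∩ L²(N)`. -/
theorem induction_integrable {p : J.L2N → Prop} (hc : IsClosed {f | p f})
    (h : ∀ f : J.L2N, Integrable f J.haar → p f) (f : J.L2N) : p f := by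
  have hd : f ∈ closure {f : J.L2N | Integrable f J.haar} := by
    refine Lp.induction (by norm_num) (motive := fun f : J.L2N =>
      f ∈ closure {f : J.L2N | Integrable f J.haar}) ?_ ?_ isClosed_closure f
    · intro c s hs hμs
      refine subset_closure ?_
      rw [Lp.simpleFunc.coe_indicatorConst]
      exact ((integrable_indicator_iff hs).2 (integrableOn_const hμs.ne)).congr
        indicatorConstLp_coeFn.symm
    · intro f g hf hg _ h1 h2
      refine map_mem_closure₂ continuous_add h1 h2 fun a ha b hb => ?_
      exact (Integrable.add ha hb).congr (Lp.coeFn_add a b).symm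
  exact (closure_minimal (fun f hf => h f hf) hc) hd

/-- The graph of the Plancherel transform is the graph of the unitary map `plancherel`. -/
theorem mem_plancherelGraph {p : J.L2N × J.DirInt} :
    p ∈ J.plancherelGraph ↔ p.2 = J.plancherel p.1 := by
  constructor
  · have hle : J.plancherelGraph ≤
        LinearMap.eqLocus (LinearMap.snd ℂ J.L2N J.DirInt)
          (J.plancherel.toLinearEquiv.toLinearMap ∘ₗ LinearMap.fst ℂ J.L2N J.DirInt) := by
      refine Submodule.topologicalClosure_minimal _ (Submodule.span_le.2 fun p hp => ?_) ?_
      · exact IsFourier.eq_plancherel J hp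
      · exact isClosed_eq continuous_snd (J.plancherel.continuous.comp continuous_fst)
    exact fun hp => hle hp
  · obtain ⟨f, T⟩ := p
    rintro (rfl : T = J.plancherel f)
    refine J.induction_integrable (p := fun f => (f, J.plancherel f) ∈ J.plancherelGraph) ?_ ?_ f
    · exact (Submodule.isClosed_topologicalClosure _).preimage
        (continuous_id.prodMk J.plancherel.continuous)
    · intro f hf
      exact Submodule.le_topologicalClosure _
        (Submodule.subset_span (J.isFourier_plancherel f hf))

theorem mem_pullback {V : (Fin m → ℝ) → Submodule ℂ (L2R d)} {f : J.L2N} :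
    f ∈ J.pullback V ↔ J.plancherel f ∈ J.fieldSub V := by
  constructor
  · rintro ⟨⟨f', T⟩, ⟨h1, h2⟩, rfl⟩
    have h3 : T = J.plancherel f' := J.mem_plancherelGraph.1 h1
    rw [h3] at h2
    exact h2
  · intro h
    exact ⟨(f, J.plancherel f), ⟨J.mem_plancherelGraph.2 rfl, h⟩, rfl⟩

end JHBasis

/-! ### Closed conditions at almost every point -/

/-- A condition imposed at almost every point, by closed sets, on a pair of `L²` functions, the
second one composed with a map `σ`, is closed. -/
theorem isClosed_setOf_ae_mem {α E : Type*} [MeasurableSpace α] {μ : Measure α}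
    [NormedAddCommGroup E] {σ : α → α} (hσ : ∀ p : α → Prop, (∀ᵐ a ∂μ, p a) → ∀ᵐ a ∂μ, p (σ a))
    {C : α → Set (E × E)} (hC : ∀ a, IsClosed (C a)) :
    IsClosed {p : Lp E 2 μ × Lp E 2 μ | ∀ᵐ a ∂μ, (p.1 a, p.2 (σ a)) ∈ C a} := by
  refine IsSeqClosed.isClosed fun p q hp hpq => ?_
  have h1 := (continuous_fst.tendsto q).comp hpq
  have h2 := (continuous_snd.tendsto q).comp hpq
  obtain ⟨ns, hns, h3⟩ := (tendstoInMeasure_of_tendsto_Lp h1).exists_seq_tendsto_ae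
  obtain ⟨ms, hms, h4⟩ := (tendstoInMeasure_of_tendsto_Lp
    (h2.comp hns.tendsto_atTop)).exists_seq_tendsto_ae
  have h5 : ∀ᵐ a ∂μ, ∀ n, ((p n).1 a, (p n).2 (σ a)) ∈ C a := ae_all_iff.2 hp
  filter_upwards [h3, hσ _ h4, h5] with a h3 h4 h5
  refine (hC a).mem_of_tendsto ((h3.comp hms.tendsto_atTop).prodMk_nhds h4) ?_
  exact .of_forall fun n => h5 _

namespace JHBasis

variable {m d : ℕ} {𝔫 : Type*} [LieRing 𝔫] [LieAlgebra ℝ 𝔫] (J : JHBasis m d 𝔫)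

/-! ### Translations under the Plancherel transform -/

theorem dotProduct_brXY (l : Fin m → ℝ) (x y : Fin d → ℝ) :
    l ⬝ᵥ J.brXY x y = x ⬝ᵥ (J.B l).mulVec y := by
  have h : ∀ v w, J.dualZ l ⁅J.linX v, J.linY w⁆ = v ⬝ᵥ (J.B l).mulVec w := by
    intro v w
    simp only [linX, linY, Fintype.linearCombination_apply, dotProduct, Matrix.mulVec, B,
      Matrix.of_apply]
    simp only [sum_lie, lie_sum, map_sum, smul_lie, lie_smul, map_smul, smul_eq_mul, Finset.mul_sum]
    rw [Finset.sum_comm]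
    exact Finset.sum_congr rfl fun i _ => Finset.sum_congr rfl fun j _ => by ring
  rw [← h, dualZ_apply]
  rfl

theorem coords_mul (g h : J.Grp) : J.coords (g * h) =
    ((J.coords g).1 + (J.coords h).1 + J.brXY (J.coords g).2.2 (J.coords h).2.1,
      (J.coords g).2.1 + (J.coords h).2.1, (J.coords g).2.2 + (J.coords h).2.2) := by
  conv_lhs => rw [← J.ofCoords_coords h, J.mul_ofCoords, J.coords_ofCoords]

theorem phase_mul (l : Fin m → ℝ) (g h : J.Grp) (t : Fin d → ℝ) :
    J.phase l (g * h) t = J.phase l g t * J.phase l h (t - (J.coords g).2.2) := by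
  simp only [phase, coords_mul, ← Complex.exp_add]
  congr 1
  rw [dotProduct_add, dotProduct_brXY, dotProduct_add, Matrix.mulVec_add, dotProduct_add,
    sub_dotProduct]
  push_cast
  ring

theorem coords_one : J.coords 1 = 0 := by
  rw [← J.coords_ofCoords 0]
  congr 1
  ext
  simp [log_ofCoords]

theorem coords_inv (g : J.Grp) : (J.coords g⁻¹).2.2 = -(J.coords g).2.2 := by
  have h := J.coords_mul g⁻¹ g
  rw [inv_mul_cancel, coords_one] at h
  exact eq_neg_of_add_eq_zero_left (congrArg (fun p => p.2.2) h).symm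

theorem conj_phase_inv (l : Fin m → ℝ) (g : J.Grp) (t : Fin d → ℝ) :
    conj (J.phase l g⁻¹ t) = J.phase l g (t + (J.coords g).2.2) := by
  have h := J.phase_mul l g⁻¹ g t
  rw [inv_mul_cancel, coords_inv, sub_neg_eq_add] at h
  have h1 : J.phase l 1 t = 1 := by simp [phase, coords_one]
  have h2 : J.phase l g⁻¹ t * conj (J.phase l g⁻¹ t) = 1 := by
    rw [Complex.mul_conj, Complex.normSq_eq_norm_sq, norm_phase]
    simp
  rw [h1, ← h2] at h
  exact mul_left_cancel₀ (left_ne_zero_of_mul_eq_one h2) h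

theorem inner_rep_mul (l : Fin m → ℝ) (g h : J.Grp) (φ ψ : L2R d) :
    ⟪ψ, J.rep l (g * h) φ⟫_ℂ = ⟪J.rep l g⁻¹ ψ, J.rep l h φ⟫_ℂ := by
  rw [inner_rep, inner_rep, ← integral_add_right_eq_self _ (J.coords g).2.2]
  refine integral_congr_ae ?_
  filter_upwards [J.coeFn_rep l g⁻¹ ψ] with t ht
  have hx : t + (J.coords g).2.2 - (J.coords (g * h)).2.2 = t - (J.coords h).2.2 := by
    rw [coords_mul]
    dsimp only
    abel
  rw [ht, map_mul (starRingEnd ℂ), conj_phase_inv, phase_mul, hx, coords_inv, sub_neg_eq_add,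
    add_sub_cancel_right]
  ring

theorem coeFn_L (g : J.Grp) (f : J.L2N) : J.L g f =ᵐ[J.haar] fun x => f (g⁻¹ * x) :=
  Lp.coeFn_compMeasurePreserving f (J.measurePreserving_mul_left g⁻¹)

/-- Left multiplication is a measurable embedding. -/
theorem measurableEmbedding_mul_left (g : J.Grp) : MeasurableEmbedding fun x : J.Grp => g * x :=
  MeasurableEquiv.measurableEmbedding ⟨Equiv.mulLeft g,
    (J.measurePreserving_mul_left g).measurable, (J.measurePreserving_mul_left g⁻¹).measurable⟩

/-- The Plancherel transform intertwines `L(g)` with `π_λ(g) ⊗ 1`. -/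
theorem coef_plancherel_L (g : J.Grp) (f : J.L2N) : ∀ᵐ l ∂J.planch, ∀ φ ψ : L2R d,
    coef (J.plancherel (J.L g f) l) φ ψ = coef (J.plancherel f l) φ (J.rep l g⁻¹ ψ) := by
  refine J.induction_integrable (p := fun f => ∀ᵐ l ∂J.planch, ∀ φ ψ : L2R d,
    coef (J.plancherel (J.L g f) l) φ ψ = coef (J.plancherel f l) φ (J.rep l g⁻¹ ψ)) ?_ ?_ f
  · let C : (Fin m → ℝ) → Set (HS d × HS d) := fun l =>
      {p | ∀ φ ψ : L2R d, coef p.1 φ ψ = coef p.2 φ (J.rep l g⁻¹ ψ)}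
    have hC (l) : IsClosed (C l) := by
      simp only [C, Set.ofPred_forall, coef_eq_inner]
      refine isClosed_iInter fun φ => isClosed_iInter fun ψ => isClosed_eq ?_ ?_ <;> fun_prop
    exact (isClosed_setOf_ae_mem (σ := id) (fun _ h => h) hC).preimage
      ((J.plancherel.continuous.comp (J.L g).continuous).prodMk J.plancherel.continuous)
  · intro f hf
    have hL : Integrable (J.L g f) J.haar :=
      ((J.measurePreserving_mul_left g⁻¹).integrable_comp_of_integrable hf).congr
        (J.coeFn_L g f).symm
    filter_upwards [(J.isFourier_plancherel f hf).2, (J.isFourier_plancherel _ hL).2]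
      with l h1 h2 φ ψ
    rw [h1, h2, ← (J.measurePreserving_mul_left g).integral_comp
      (J.measurableEmbedding_mul_left g)]
    refine integral_congr_ae ?_
    filter_upwards [(J.measurePreserving_mul_left g).quasiMeasurePreserving.ae (J.coeFn_L g f)]
      with x hx
    rw [hx, inv_mul_cancel_left, inner_rep_mul]

/-! ### Dilations under the Plancherel transform -/

theorem coords_A_zpow (j : ℤ) (g : J.Grp) : J.coords ((J.A ^ j) g) =
    ((2 : ℝ) ^ j • (J.coords g).1, (2 : ℝ) ^ j • (J.coords g).2.1, (J.coords g).2.2) := by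
  conv_lhs => rw [← J.ofCoords_coords g]
  rw [← J.coords_ofCoords (_, _)]
  congr 1
  exact J.A_zpow_ofCoords j _ _ _

theorem map_A_zpow (j : ℤ) : Measure.map ⇑(J.A ^ j) J.haar =
    ENNReal.ofReal (((2 : ℝ) ^ j) ^ (m + d))⁻¹ • J.haar := by
  set r : ℝ := (2 : ℝ) ^ j with hr
  have hr0 : 0 < r := by positivity
  let T : (Fin m → ℝ) × (Fin d → ℝ) × (Fin d → ℝ) → (Fin m → ℝ) × (Fin d → ℝ) × (Fin d → ℝ) :=
    Prod.map (r • ·) (Prod.map (r • ·) id)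
  have hT : Measurable T :=
    (measurable_const_smul r).prodMap ((measurable_const_smul r).prodMap measurable_id)
  have hA : ⇑(J.A ^ j) = J.coords.symm ∘ T ∘ J.coords := by
    ext1 g
    conv_lhs => rw [← J.ofCoords_coords g]
    exact J.A_zpow_ofCoords j _ _ _
  have hTv : Measure.map T volume = ENNReal.ofReal (r ^ (m + d))⁻¹ • volume := by
    have e1 := Measure.map_addHaar_smul (volume : Measure (Fin m → ℝ)) hr0.ne'
    have e2 := Measure.map_addHaar_smul (volume : Measure (Fin d → ℝ)) hr0.ne'
    rw [Module.finrank_fin_fun] at e1 e2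
    rw [Measure.volume_eq_prod, Measure.volume_eq_prod,
      ← Measure.map_prod_map _ _ (measurable_const_smul r)
        ((measurable_const_smul r).prodMap measurable_id),
      ← Measure.map_prod_map _ _ (measurable_const_smul r) measurable_id, e1, e2, Measure.map_id,
      Measure.prod_smul_left, Measure.prod_smul_left, Measure.prod_smul_right, smul_smul,
      ← ENNReal.ofReal_mul (abs_nonneg _), ← abs_mul, abs_of_pos (by positivity), pow_add, mul_inv]
  rw [hA, ← Measure.map_map J.coords.symm.measurable (hT.comp J.coords.measurable),
    ← Measure.map_map hT J.coords.measurable, J.measurePreserving_coords.map_eq, hTv,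
    Measure.map_smul]
  rfl

theorem measurable_A_zpow (j : ℤ) : Measurable ⇑(J.A ^ j) := (J.exists_map_A_zpow j).1

theorem measurableEmbedding_A_zpow (j : ℤ) : MeasurableEmbedding ⇑(J.A ^ j) :=
  MeasurableEquiv.measurableEmbedding ⟨(J.A ^ j).toEquiv, J.measurable_A_zpow j, by
    have h := J.measurable_A_zpow (-j)
    rw [zpow_neg] at h
    exact h⟩

theorem ae_A_zpow (j : ℤ) {p : J.Grp → Prop} (h : ∀ᵐ x ∂J.haar, p x) :
    ∀ᵐ x ∂J.haar, p ((J.A ^ j) x) := by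
  have hq : Measure.QuasiMeasurePreserving ⇑(J.A ^ j) J.haar J.haar := by
    refine ⟨J.measurable_A_zpow j, ?_⟩
    rw [map_A_zpow]
    exact Measure.smul_absolutelyContinuous
  exact hq.ae h

theorem integral_comp_A_zpow (j : ℤ) (h : J.Grp → ℂ) : ∫ x, h ((J.A ^ j) x) ∂J.haar =
    ((((2 : ℝ) ^ j) ^ (m + d))⁻¹ : ℝ) * ∫ x, h x ∂J.haar := by
  rw [← (J.measurableEmbedding_A_zpow j).integral_map, map_A_zpow, integral_smul_measure,
    ENNReal.toReal_ofReal (by positivity)]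
  simp

theorem A_zpow_neg_apply (j : ℤ) (x : J.Grp) : (J.A ^ (-j)) ((J.A ^ j) x) = x := by
  rw [← MulAut.mul_apply, ← zpow_add, neg_add_cancel, zpow_zero, MulAut.one_apply]

/-- The normalising factor of `D_{A^j}`. -/
def dilationFactor (m d : ℕ) (j : ℤ) : ℝ := (2 : ℝ) ^ (-(j : ℝ) * ((m + d : ℕ) : ℝ) / 2)

theorem dilationFactor_mul_self (m d : ℕ) (j : ℤ) :
    dilationFactor m d j * dilationFactor m d j = (((2 : ℝ) ^ j) ^ (m + d))⁻¹ := by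
  rw [dilationFactor, ← Real.rpow_add (by norm_num), add_halves, neg_mul,
    Real.rpow_neg (by norm_num), Real.rpow_mul (by norm_num), Real.rpow_natCast,
    Real.rpow_intCast]

theorem dilationFactor_mul_neg (m d : ℕ) (j : ℤ) :
    dilationFactor m d j * dilationFactor m d (-j) = 1 := by
  rw [dilationFactor, dilationFactor, ← Real.rpow_add (by norm_num)]
  convert Real.rpow_zero 2 using 2
  push_cast
  ring

theorem coeFn_D (j : ℤ) (f : J.L2N) :
    J.D j f =ᵐ[J.haar] fun x => (dilationFactor m d j : ℂ) * f ((J.A ^ (-j)) x) :=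
  (J.memLp_dilation j f).coeFn_toLp

theorem inner_D_D (j : ℤ) (f g : J.L2N) : ⟪J.D j f, J.D j g⟫_ℂ = ⟪f, g⟫_ℂ := by
  have h : ⟪J.D j f, J.D j g⟫_ℂ =
      ∫ x, ((dilationFactor m d j * dilationFactor m d j : ℝ) : ℂ) *
        ⟪f ((J.A ^ (-j)) x), g ((J.A ^ (-j)) x)⟫_ℂ ∂J.haar := by
    rw [L2.inner_def]
    refine integral_congr_ae ?_
    filter_upwards [J.coeFn_D j f, J.coeFn_D j g] with x h1 h2
    rw [h1, h2, RCLike.inner_apply, RCLike.inner_apply, map_mul, Complex.conj_ofReal]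
    push_cast
    ring
  rw [h, integral_const_mul, J.integral_comp_A_zpow (-j) (fun x => ⟪f x, g x⟫_ℂ), ← mul_assoc,
    ← Complex.ofReal_mul, dilationFactor_mul_self, zpow_neg, inv_pow, inv_inv,
    inv_mul_cancel₀ (by positivity), Complex.ofReal_one, one_mul, L2.inner_def]

theorem D_D_neg (j : ℤ) (f : J.L2N) : J.D j (J.D (-j) f) = f := by
  refine Lp.ext ?_
  filter_upwards [J.coeFn_D j (J.D (-j) f), J.ae_A_zpow (-j) (J.coeFn_D (-j) f)] with x h1 h2
  rw [h1, h2, A_zpow_neg_apply, ← mul_assoc, ← Complex.ofReal_mul, dilationFactor_mul_neg,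
    Complex.ofReal_one, one_mul]

theorem isometry_D (j : ℤ) : Isometry (J.D j) := by
  refine Isometry.of_dist_eq fun f g => ?_
  have h (f g : J.L2N) : ‖f - g‖ ^ 2 = RCLike.re ⟪f, f⟫_ℂ - 2 * RCLike.re ⟪f, g⟫_ℂ +
      RCLike.re ⟪g, g⟫_ℂ := by
    rw [@norm_sub_sq ℂ, inner_self_eq_norm_sq, inner_self_eq_norm_sq]
  rw [dist_eq_norm, dist_eq_norm]
  refine (sq_eq_sq₀ (norm_nonneg _) (norm_nonneg _)).1 ?_
  rw [h, h, inner_D_D, inner_D_D, inner_D_D]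

theorem phase_A_zpow (j : ℤ) (l : Fin m → ℝ) (x : J.Grp) (t : Fin d → ℝ) :
    J.phase l ((J.A ^ j) x) t = J.phase ((2 : ℝ) ^ j • l) x t := by
  simp only [phase, coords_A_zpow, B_smul, Matrix.mulVec_smul, Matrix.smul_mulVec, dotProduct_smul,
    smul_dotProduct]

theorem inner_rep_A_zpow (j : ℤ) (l : Fin m → ℝ) (x : J.Grp) (φ ψ : L2R d) :
    ⟪ψ, J.rep l ((J.A ^ j) x) φ⟫_ℂ = ⟪ψ, J.rep ((2 : ℝ) ^ j • l) x φ⟫_ℂ := by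
  simp only [inner_rep, phase_A_zpow, coords_A_zpow]

/-- The Plancherel transform turns `D_{A^j}` into the dilation `λ ↦ 2^j λ` of fields of
operators, because `π_λ ∘ A^j = π_{2^j λ}`. -/
theorem plancherel_D (j : ℤ) (f : J.L2N) : ∀ᵐ l ∂J.planch, J.plancherel (J.D j f) l =
    ((dilationFactor m d j * ((2 : ℝ) ^ j) ^ (m + d) : ℝ) : ℂ) •
      J.plancherel f ((2 : ℝ) ^ j • l) := by
  set c : ℂ := ((dilationFactor m d j * ((2 : ℝ) ^ j) ^ (m + d) : ℝ) : ℂ) with hc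
  refine J.induction_integrable (p := fun f => ∀ᵐ l ∂J.planch, J.plancherel (J.D j f) l =
    c • J.plancherel f ((2 : ℝ) ^ j • l)) ?_ ?_ f
  · have hC : IsClosed {p : HS d × HS d | p.1 = c • p.2} :=
      isClosed_eq continuous_fst (continuous_snd.const_smul c)
    exact (isClosed_setOf_ae_mem (σ := fun l => (2 : ℝ) ^ j • l)
      (fun _ h => J.ae_planch_smul (by positivity) h) fun _ => hC).preimage
      ((J.plancherel.continuous.comp (J.isometry_D j).continuous).prodMk J.plancherel.continuous)
  · intro f hf
    have hf' : Integrable (fun x => f ((J.A ^ (-j)) x)) J.haar := by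
      refine (integrable_map_measure (f := ⇑(J.A ^ (-j))) (g := f) ?_
        (J.measurable_A_zpow (-j)).aemeasurable).1 ?_
      · exact (Lp.stronglyMeasurable f).aestronglyMeasurable
      · rw [map_A_zpow]
        exact hf.smul_measure ENNReal.ofReal_ne_top
    have hD : Integrable (J.D j f) J.haar := (hf'.const_mul _).congr (J.coeFn_D j f).symm
    filter_upwards [J.ae_planch_smul (r := (2 : ℝ) ^ j) (by positivity)
      (J.isFourier_plancherel f hf).2, (J.isFourier_plancherel _ hD).2] with l h1 h2
    refine eq_of_coef fun φ ψ => ?_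
    rw [h2, coef_eq_inner, inner_smul_right, ← coef_eq_inner, h1]
    have h3 : ∫ x, J.D j f x * ⟪ψ, J.rep l x φ⟫_ℂ ∂J.haar = (dilationFactor m d j : ℂ) *
        ∫ x, f ((J.A ^ (-j)) x) * ⟪ψ, J.rep l x φ⟫_ℂ ∂J.haar := by
      rw [← integral_const_mul]
      refine integral_congr_ae ?_
      filter_upwards [J.coeFn_D j f] with x hx
      rw [hx, mul_assoc]
    have h4 := J.integral_comp_A_zpow j fun x => f ((J.A ^ (-j)) x) * ⟪ψ, J.rep l x φ⟫_ℂ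
    simp only [A_zpow_neg_apply, inner_rep_A_zpow] at h4
    rw [h3, h4, hc, ← mul_assoc, ← Complex.ofReal_mul, mul_assoc, mul_inv_cancel₀ (by positivity),
      mul_one]

/-! ### The spaces `H_S` -/

theorem isClosed_fieldSub (V : (Fin m → ℝ) → Submodule ℂ (L2R d)) :
    IsClosed (J.fieldSub V : Set J.DirInt) :=
  (isClosed_setOf_ae_mem (μ := J.planch) (σ := id) (C := fun l => {p | p.1 ∈ tensorSub (V l)})
    (fun _ h => h) fun l => (isClosed_tensorSub (V l)).preimage continuous_fst).preimage
      (continuous_id.prodMk continuous_id)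

theorem isClosed_pullback (V : (Fin m → ℝ) → Submodule ℂ (L2R d)) :
    IsClosed (J.pullback V : Set J.L2N) := by
  have h : (J.pullback V : Set J.L2N) = J.plancherel ⁻¹' (J.fieldSub V) := by
    ext f
    exact J.mem_pullback
  rw [h]
  exact (J.isClosed_fieldSub V).preimage J.plancherel.continuous

theorem mem_fieldSub {V : (Fin m → ℝ) → Submodule ℂ (L2R d)} {T : J.DirInt} :
    T ∈ J.fieldSub V ↔ ∀ᵐ l ∂J.planch, T l ∈ tensorSub (V l) := Iff.rfl

theorem pullback_congr {V V' : (Fin m → ℝ) → Submodule ℂ (L2R d)}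
    (h : ∀ᵐ l ∂J.planch, V l = V' l) : J.pullback V = J.pullback V' := by
  ext f
  rw [mem_pullback, mem_pullback, mem_fieldSub, mem_fieldSub]
  refine Filter.eventually_congr ?_
  filter_upwards [h] with l hl
  rw [hl]

/-- Left translations act on the first tensor factor only. -/
theorem L_mem_pullback {V : (Fin m → ℝ) → Submodule ℂ (L2R d)}
    [∀ l, (V l).HasOrthogonalProjection] (g : J.Grp) {f : J.L2N} (hf : f ∈ J.pullback V) :
    J.L g f ∈ J.pullback V := by
  rw [mem_pullback] at hf ⊢
  filter_upwards [hf, J.coef_plancherel_L g f] with l h1 h2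
  rw [mem_tensorSub_iff] at h1 ⊢
  intro ψ v hv
  rw [h2, h1 _ v hv]

theorem D_mem_pullback {V V' : (Fin m → ℝ) → Submodule ℂ (L2R d)} (j : ℤ)
    (hV : ∀ l, V ((2 : ℝ) ^ j • l) = V' l) {f : J.L2N} (hf : f ∈ J.pullback V) :
    J.D j f ∈ J.pullback V' := by
  rw [mem_pullback] at hf ⊢
  filter_upwards [J.ae_planch_smul (r := (2 : ℝ) ^ j) (by positivity) hf, J.plancherel_D j f]
    with l h1 h2
  rw [h2, ← hV]
  exact Submodule.smul_mem _ _ h1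

theorem tensorSub_bot : tensorSub (⊥ : Submodule ℂ (L2R d)) = ⊥ := by
  rw [eq_bot_iff]
  refine Submodule.topologicalClosure_minimal _ (Submodule.span_le.2 ?_) isClosed_singleton
  rintro _ ⟨φ, v, hv, rfl⟩
  rw [(Submodule.mem_bot ℂ).1 hv]
  exact tensor_zero_right φ

theorem mem_H {u : L2R d} {S : Set (Fin m → ℝ)} {f : J.L2N} : f ∈ J.H u S ↔
    ∀ᵐ l ∂J.planch, J.plancherel f l ∈ tensorSub (Submodule.span ℂ {u}) ∧
      (l ∉ S → J.plancherel f l = 0) := by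
  rw [H, mem_pullback, mem_fieldSub]
  refine Filter.eventually_congr (.of_forall fun l => ?_)
  by_cases hl : l ∈ S
  · simp [hl]
  · simp only [hl, if_false, tensorSub_bot, Submodule.mem_bot, not_false_eq_true, true_imp_iff]
    exact ⟨fun h => ⟨h ▸ zero_mem _, h⟩, fun h => h.2⟩

theorem H_mono {u : L2R d} {S S' : Set (Fin m → ℝ)} (h : S ⊆ S') : J.H u S ≤ J.H u S' := by
  intro f hf
  rw [mem_H] at hf ⊢
  filter_upwards [hf] with l hl
  exact ⟨hl.1, fun hS => hl.2 fun h' => hS (h h')⟩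

/-- The part of `f` whose Plancherel transform lives on `S`. -/
def cut {S : Set (Fin m → ℝ)} (hS : MeasurableSet S) (f : J.L2N) : J.L2N :=
  J.plancherel.symm (((Lp.memLp (J.plancherel f)).indicator hS).toLp _)

theorem plancherel_cut {S : Set (Fin m → ℝ)} (hS : MeasurableSet S) (f : J.L2N) :
    J.plancherel (J.cut hS f) =ᵐ[J.planch] S.indicator (J.plancherel f) := by
  rw [cut, LinearIsometryEquiv.apply_symm_apply]
  exact MemLp.coeFn_toLp _

theorem cut_mem_H {u : L2R d} {S S' : Set (Fin m → ℝ)} (hS : MeasurableSet S) {f : J.L2N}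
    (hf : f ∈ J.H u S') : J.cut hS f ∈ J.H u S := by
  rw [mem_H] at hf ⊢
  filter_upwards [hf, J.plancherel_cut hS f] with l h1 h2
  rw [h2]
  by_cases hl : l ∈ S
  · simp [hl, h1.1]
  · simp [hl]

/-- `cut` is the orthogonal projection onto the functions with transform supported on `S`. -/
theorem inner_cut {u : L2R d} {S : Set (Fin m → ℝ)} (hS : MeasurableSet S) {a : J.L2N}
    (ha : a ∈ J.H u S) (f : J.L2N) : ⟪a, J.cut hS f⟫_ℂ = ⟪a, f⟫_ℂ := by
  rw [← J.plancherel.inner_map_map, ← J.plancherel.inner_map_map, L2.inner_def, L2.inner_def]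
  refine integral_congr_ae ?_
  filter_upwards [J.mem_H.1 ha, J.plancherel_cut hS f] with l h1 h2
  rw [h2]
  by_cases hl : l ∈ S
  · simp [hl]
  · simp [h1.2 hl]

theorem norm_sq_eq_integral (f : J.L2N) :
    ‖f‖ ^ 2 = ∫ l, ‖J.plancherel f l‖ ^ 2 ∂J.planch := by
  have h : ((‖f‖ ^ 2 : ℝ) : ℂ) = ((∫ l, ‖J.plancherel f l‖ ^ 2 ∂J.planch : ℝ) : ℂ) := by
    rw [← integral_complex_ofReal, Complex.ofReal_pow]
    refine (inner_self_eq_norm_sq_to_K (𝕜 := ℂ) f).symm.trans ?_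
    rw [← J.plancherel.inner_map_map, L2.inner_def]
    refine integral_congr_ae (.of_forall fun l => ?_)
    exact (inner_self_eq_norm_sq_to_K (𝕜 := ℂ) _).trans (by norm_cast)
  exact_mod_cast h

theorem norm_cut_sq {S : Set (Fin m → ℝ)} (hS : MeasurableSet S) (f : J.L2N) :
    ‖J.cut hS f‖ ^ 2 = ∫ l in S, ‖J.plancherel f l‖ ^ 2 ∂J.planch := by
  rw [norm_sq_eq_integral, ← integral_indicator hS]
  refine integral_congr_ae ?_
  filter_upwards [J.plancherel_cut hS f] with l h
  rw [h]
  by_cases hl : l ∈ S <;> simp [hl]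

theorem hasSum_norm_cut_sq {S : ℤ → Set (Fin m → ℝ)} (hS : ∀ j, MeasurableSet (S j))
    (hd : Pairwise (Function.onFun Disjoint S)) (hU : ∀ᵐ l ∂J.planch, l ∈ ⋃ j, S j) (f : J.L2N) :
    HasSum (fun j => ‖J.cut (hS j) f‖ ^ 2) (‖f‖ ^ 2) := by
  simp only [norm_cut_sq]
  have hi : Integrable (fun l => ‖J.plancherel f l‖ ^ 2) J.planch :=
    (Lp.memLp (J.plancherel f)).integrable_norm_pow (p := 2) (by norm_num)
  have h := hasSum_integral_iUnion hS hd hi.integrableOn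
  rwa [Measure.restrict_eq_self_of_ae_mem hU, ← norm_sq_eq_integral] at h

/-! ### The dyadic tiling of `Σ` -/

/-- The dilate `2^{-j} E`. -/
def tile (j : ℤ) : Set (Fin m → ℝ) := (fun l => (2 : ℝ) ^ (-j) • l) '' J.E

theorem smul_mem_sig_iff {r : ℝ} (hr : r ≠ 0) {l : Fin m → ℝ} : r • l ∈ J.sig ↔ l ∈ J.sig := by
  simp [sig, B_smul, hr]

/-- In the supremum norm, `E` is the shell `1/4 < ‖λ‖ ≤ 1/2` of `Σ`. -/
theorem mem_E_iff {l : Fin m → ℝ} : l ∈ J.E ↔ l ∈ J.sig ∧ ‖l‖ ∈ Set.Ioc (1 / 4 : ℝ) (1 / 2) := by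
  have h (r : ℝ) (hr : 0 ≤ r) :
      l ∈ Set.Icc (fun _ : Fin m => -r) (fun _ => r) ↔ ‖l‖ ≤ r := by
    rw [pi_norm_le_iff_of_nonneg hr]
    simp only [Set.mem_Icc, Pi.le_def, Real.norm_eq_abs, abs_le, forall_and]
  have h1 := h (1 / 2) (by norm_num)
  have h2 := h (1 / 4) (by norm_num)
  rw [E, Set.mem_inter_iff, Set.mem_sdiff, neg_div, neg_div, h1, h2, not_le, Set.mem_Ioc]
  tauto

theorem zpow_smul_zpow_neg (j : ℤ) (l : Fin m → ℝ) :
    (2 : ℝ) ^ j • (2 : ℝ) ^ (-j) • l = l := by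
  rw [smul_smul, ← zpow_add₀ (by norm_num), add_neg_cancel, zpow_zero, one_smul]

theorem mem_tile_iff_smul {j : ℤ} {l : Fin m → ℝ} : l ∈ J.tile j ↔ (2 : ℝ) ^ j • l ∈ J.E := by
  constructor
  · rintro ⟨l, hl, rfl⟩
    simpa only [zpow_smul_zpow_neg] using hl
  · intro hl
    exact ⟨_, hl, by simpa only [neg_neg] using zpow_smul_zpow_neg (-j) l⟩

theorem mem_tile_iff {j : ℤ} {l : Fin m → ℝ} : l ∈ J.tile j ↔
    l ∈ J.sig ∧ ‖l‖ ∈ Set.Ioc ((2 : ℝ) ^ (-j - 2)) ((2 : ℝ) ^ (-j - 2 + 1)) := by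
  have h0 : (0 : ℝ) < 2 ^ j := by positivity
  have e1 : (2 : ℝ) ^ (-j - 2) = (1 / 4) / 2 ^ j := by
    rw [zpow_sub₀ (by norm_num), zpow_neg]
    field_simp
    norm_num
  have e2 : (2 : ℝ) ^ (-j - 2 + 1) = (1 / 2) / 2 ^ j := by
    rw [zpow_add₀ (by norm_num), e1]
    field_simp
    norm_num
  rw [mem_tile_iff_smul, mem_E_iff, J.smul_mem_sig_iff h0.ne', norm_smul,
    Real.norm_of_nonneg h0.le, e1, e2, Set.mem_Ioc, Set.mem_Ioc, div_lt_iff₀' h0, le_div_iff₀' h0]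

theorem measurableSet_tile (j : ℤ) : MeasurableSet (J.tile j) := by
  have : J.tile j = J.sig ∩
      norm ⁻¹' Set.Ioc ((2 : ℝ) ^ (-j - 2)) ((2 : ℝ) ^ (-j - 2 + 1)) := by
    ext l
    exact J.mem_tile_iff
  rw [this]
  exact J.measurableSet_sig.inter (measurable_norm measurableSet_Ioc)

theorem tile_subset_sig (j : ℤ) : J.tile j ⊆ J.sig := fun _ hl => (J.mem_tile_iff.1 hl).1

theorem pairwise_disjoint_tile : Pairwise (Function.onFun Disjoint J.tile) := by
  have key : ∀ j k, j < k → Disjoint (J.tile j) (J.tile k) := by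
    intro j k hjk
    refine Set.disjoint_left.2 fun l h1 h2 => ?_
    have h3 := (J.mem_tile_iff.1 h1).2.1
    have h4 := (J.mem_tile_iff.1 h2).2.2
    exact absurd (zpow_le_zpow_right₀ (by norm_num : (1 : ℝ) ≤ 2) (by omega : -k - 2 + 1 ≤ -j - 2))
      (not_le.2 (h3.trans_le h4))
  intro j k hjk
  rcases lt_or_gt_of_ne hjk with h | h
  · exact key j k h
  · exact (key k j h).symm

/-- `0 ∉ Σ` as soon as `𝔫` is not abelian: then `d > 0`, and `B(0) = 0` is singular. -/
theorem ne_zero_of_mem_sig (hN : ¬ IsLieAbelian 𝔫) {l : Fin m → ℝ} (hl : l ∈ J.sig) : l ≠ 0 := by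
  rintro rfl
  rcases Nat.eq_zero_or_pos d with rfl | hd
  · refine hN ⟨fun v w => ?_⟩
    rw [J.lie_eq v w, show J.projX v = 0 from Subsingleton.elim _ _,
      show J.projX w = 0 from Subsingleton.elim _ _, map_zero, zero_lie, lie_zero, add_zero]
  · have : Nonempty (Fin d) := ⟨⟨0, hd⟩⟩
    have h0 : J.B 0 = 0 := by simpa using J.B_smul 0 0
    exact hl (by rw [h0]; exact Matrix.det_zero)

theorem iUnion_tile (hN : ¬ IsLieAbelian 𝔫) {l : Fin m → ℝ} (hl : l ∈ J.sig) :
    l ∈ ⋃ j, J.tile j := by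
  obtain ⟨n, hn⟩ := exists_mem_Ioc_zpow (norm_pos_iff.2 (J.ne_zero_of_mem_sig hN hl)) one_lt_two
  refine Set.mem_iUnion.2 ⟨-n - 2, J.mem_tile_iff.2 ⟨hl, ?_⟩⟩
  rwa [show -(-n - 2) - 2 = n by ring]

theorem tile_zero : J.tile 0 = J.E := by
  ext l
  simp [mem_tile_iff_smul]

theorem D_mem_H_tile {u : L2R d} (j k : ℤ) {f : J.L2N} (hf : f ∈ J.H u (J.tile k)) :
    J.D j f ∈ J.H u (J.tile (k + j)) := by
  refine J.D_mem_pullback j (fun l => ?_) hf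
  have : (2 : ℝ) ^ j • l ∈ J.tile k ↔ l ∈ J.tile (k + j) := by
    rw [mem_tile_iff_smul, mem_tile_iff_smul, smul_smul, zpow_add₀ (by norm_num)]
  by_cases h : l ∈ J.tile (k + j)
  · simp only [if_pos h, if_pos (this.2 h)]
  · simp only [if_neg h, if_neg fun h' => h (this.1 h')]

/-! ### Assembling the frame -/

theorem HE_eq (u : L2R d) : J.HE u = J.H u (J.tile 0) := by rw [tile_zero]; rfl

theorem H_tile_le (u : L2R d) (j : ℤ) : J.H u (J.tile j) ≤ J.H u J.sig :=
  J.H_mono (J.tile_subset_sig j)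

theorem inner_eq_zero_of_disjoint {u : L2R d} {S S' : Set (Fin m → ℝ)} (h : Disjoint S S')
    {a b : J.L2N} (ha : a ∈ J.H u S) (hb : b ∈ J.H u S') : ⟪a, b⟫_ℂ = 0 := by
  rw [← J.plancherel.inner_map_map, L2.inner_def]
  refine integral_eq_zero_of_ae ?_
  filter_upwards [J.mem_H.1 ha, J.mem_H.1 hb] with l h1 h2
  by_cases hl : l ∈ S
  · simp [h2.2 (Set.disjoint_left.1 h hl)]
  · simp [h1.2 hl]

theorem orthogonalFamily_H_tile (u : L2R d) :
    OrthogonalFamily ℂ (fun j : ℤ => J.H u (J.tile j)) fun j => (J.H u (J.tile j)).subtypeₗᵢ :=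
  fun _ _ hjk a b => J.inner_eq_zero_of_disjoint (J.pairwise_disjoint_tile hjk) a.2 b.2

theorem hasSum_norm_cut_tile (hN : ¬ IsLieAbelian 𝔫) (g : J.L2N) :
    HasSum (fun j => ‖J.cut (J.measurableSet_tile j) g‖ ^ 2) (‖g‖ ^ 2) :=
  J.hasSum_norm_cut_sq J.measurableSet_tile J.pairwise_disjoint_tile
    (J.ae_planch_mem_sig.mono fun _ hl => J.iUnion_tile hN hl) g

/-- The spaces `H_E^j` span a dense subspace of `H_Σ`, since a function in `H_Σ` orthogonal to all
`H_E^j` has all its pieces `cut` equal to zero. -/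
theorem topologicalClosure_iSup_H_tile (hN : ¬ IsLieAbelian 𝔫) (u : L2R d) :
    (⨆ j : ℤ, J.H u (J.tile j)).topologicalClosure = J.H u J.sig := by
  set K := (⨆ j : ℤ, J.H u (J.tile j)).topologicalClosure with hK
  have hle : K ≤ J.H u J.sig := Submodule.topologicalClosure_minimal _
    (iSup_le fun j => J.H_tile_le u j) (J.isClosed_pullback _)
  have : CompleteSpace K := (Submodule.isClosed_topologicalClosure _).completeSpace_coe
  refine le_antisymm hle fun g hg => ?_
  -- The component `r` of `g` orthogonal to `K` is orthogonal to its own pieces, so these vanish.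
  set r := g - K.starProjection g with hr
  have hr1 : r ∈ J.H u J.sig := sub_mem hg (hle (Submodule.starProjection_apply_mem _ _))
  have hr2 : r ∈ Kᗮ := Submodule.sub_starProjection_mem_orthogonal _
  have hcut (j : ℤ) : J.cut (J.measurableSet_tile j) r = 0 := by
    have h1 := J.cut_mem_H (J.measurableSet_tile j) hr1
    have h2 : J.cut (J.measurableSet_tile j) r ∈ K :=
      Submodule.le_topologicalClosure _ (Submodule.mem_iSup_of_mem j h1)
    have h3 := J.inner_cut (J.measurableSet_tile j) h1 r
    rw [(Submodule.mem_orthogonal _ _).1 hr2 _ h2] at h3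
    exact inner_self_eq_zero.1 h3
  have h0 : ‖r‖ ^ 2 = 0 := by
    refine (J.hasSum_norm_cut_tile hN r).unique ?_
    simp [hcut]
  have h1 : r = 0 := by simpa using h0
  rw [sub_eq_zero.1 h1]
  exact Submodule.starProjection_apply_mem _ _

theorem isMultiplicityFree_H_sig {u : L2R d} (hu : u ≠ 0) : J.IsMultiplicityFree (J.H u J.sig) := by
  have e : J.H u J.sig = J.pullback fun _ => Submodule.span ℂ {u} := by
    refine J.pullback_congr ?_
    filter_upwards [J.ae_planch_mem_sig] with l hl
    rw [if_pos hl]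
  have hP : ((Submodule.span ℂ {u}).starProjection : L2R d →ₗ[ℂ] L2R d).range =
      Submodule.span ℂ {u} := Submodule.range_starProjection _
  rw [e]
  refine ⟨J.isClosed_pullback _, fun g f hf => J.L_mem_pullback g hf,
    fun _ => (Submodule.span ℂ {u}).starProjection, fun _ => isStarProjection_starProjection,
    fun _ _ => measurable_const, .of_forall fun _ => ?_, ?_⟩
  · rw [hP, finrank_span_singleton hu]
  · simp only [hP]

/-- The dilates of a Parseval frame for `H_E` form a Parseval frame for `H_Σ`: the coefficients at
scale `j` see only the piece of `g` over `2^{-j} E`, dilated back to `E`. -/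
theorem isParsevalFrame_D (hN : ¬ IsLieAbelian 𝔫) {ι : Type*} {u : L2R d} {v : ι → J.L2N}
    (hv : IsParsevalFrame (J.HE u) v) :
    IsParsevalFrame (J.H u J.sig) fun p : ι × ℤ => J.D p.2 (v p.1) := by
  rw [HE_eq] at hv
  have hD (i : ι) (j : ℤ) : J.D j (v i) ∈ J.H u (J.tile j) := by
    simpa using J.D_mem_H_tile j 0 (hv.1 i)
  refine ⟨fun p => J.H_tile_le u p.2 (hD p.1 p.2), fun g hg => ?_⟩
  have hj (j : ℤ) : HasSum (fun i => ‖⟪J.D j (v i), g⟫_ℂ‖ ^ 2)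
      (‖J.cut (J.measurableSet_tile j) g‖ ^ 2) := by
    set c := J.cut (J.measurableSet_tile j) g with hc
    have h1 : J.D (-j) c ∈ J.H u (J.tile 0) := by
      simpa using J.D_mem_H_tile (-j) j (J.cut_mem_H (J.measurableSet_tile j) hg)
    have h2 (a : J.L2N) : ⟪J.D j a, c⟫_ℂ = ⟪a, J.D (-j) c⟫_ℂ := by
      conv_lhs => rw [← J.D_D_neg j c, inner_D_D]
    have h3 : ‖J.D (-j) c‖ ^ 2 = ‖c‖ ^ 2 := by
      rw [← inner_self_eq_norm_sq (𝕜 := ℂ), inner_D_D, inner_self_eq_norm_sq]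
    have h4 := hv.2 _ h1
    rw [h3] at h4
    refine h4.congr_fun ?_
    intro i
    rw [← h2, hc, J.inner_cut _ (hD i j)]
  have hsum := J.hasSum_norm_cut_tile hN g
  have hs : Summable fun p : ℤ × ι => ‖⟪J.D p.1 (v p.2), g⟫_ℂ‖ ^ 2 := by
    refine (summable_prod_of_nonneg fun p => by positivity).2 ⟨fun j => (hj j).summable, ?_⟩
    simpa only [(hj _).tsum_eq] using hsum.summable
  have h := hs.hasSum
  rw [← hsum.unique (h.prod_fiberwise hj)] at h
  exact (Equiv.prodComm ι ℤ).hasSum_iff.2 h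

end JHBasis

end

theorem mainTheorem2 {m d : ℕ} {𝔫 : Type*} [LieRing 𝔫] [LieAlgebra ℝ 𝔫] (J : JHBasis m d 𝔫)
    (hN : ¬ IsLieAbelian 𝔫) (u : JHBasis.L2R d) (hu : ‖u‖ = 1) (f : J.L2N)
    (hf : IsParsevalFrame (J.HE u) (fun γ : J.Γ => J.L γ f)) :
    IsParsevalFrame (J.H u J.sig) (fun p : J.Γ × ℤ => J.D p.2 (J.L p.1 f)) ∧
    J.IsMultiplicityFree (J.H u J.sig) ∧
    OrthogonalFamily ℂ (fun j : ℤ => J.HEj u j) (fun j => (J.HEj u j).subtypeₗᵢ) ∧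
    (⨆ j : ℤ, J.HEj u j).topologicalClosure = J.H u J.sig :=
  ⟨J.isParsevalFrame_D hN hf,
    J.isMultiplicityFree_H_sig (norm_ne_zero_iff.1 (hu ▸ one_ne_zero)),
    J.orthogonalFamily_H_tile u, J.topologicalClosure_iSup_H_tile hN u⟩
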